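/- **Setting.** Let $n,m,d,K$ be natural numbers with $1\le K<n$ and $m\ge 1$. A dataset is an $n$-tuple $X=(x_1,\dots,x_n)$ of records $x_i\in\mathbb R^d$, with the Euclidean norm. We write $X\sim\mathcal N(\mu,\Sigma)$ if the records of $X$ are independent with law $\mathcal N(\mu,\Sigma)$. *SMOTE.* Given a dataset $X$, a SMOTE sample is $z=x_i+w(x_j-x_i)$, where $i$ is uniform in $\{1,\dots,n\}$, $j$ is uniform among the $K$ nearest neighbours of $x_i$ in $\{x_k: k\ne i\}$ (equal distances are ordered by the index), and $w$ is uniform in $[0,1]$. The SMOTE-transformed dataset $X_S=f_S(X)$ consists of $m$ SMOTE samples that are independent given $X$. *Sensitivity.* For a random dataset $Y$ let $\mu_Y$ and $\Sigma_Y$ be the mean vector and the covariance matrix of a uniformly chosen record of $Y$. Let $\Theta$ be a set of pairs $(\mu,\Sigma)$ with $\mu\in\mathbb R^d$ and $\Sigma\neq 0$ a symmetric positive semidefinite $d\times d$ matrix; a single pair, $\Theta=\{(\mu,\Sigma)\}$, is the basic case. A pair of neighbouring datasets is a pair of random datasets $(X,X')$ of size $n$ on a common probability space such that $X\sim\mathcal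 N(\mu,\Sigma)$ and $X'\sim\mathcal N(\mu',\Sigma')$ with $(\mu,\Sigma),(\mu',\Sigma')\in\Theta$ and such that, almost surely, $X$ and $X'$ differ in at most one record. The sensitivity of a (possibly random) generative model $f$ is $$\Delta(f)=\max_{(X,X')}\Bigl(\|\mu_{f(X)}-\mu_{f(X')}\|+\operatorname{tr}\bigl(\Sigma_{f(X)}+\Sigma_{f(X')}\bigr)\Bigr),$$ the maximum being over all pairs of neighbouring datasets. Write $\Delta f$ for the sensitivity of the identity (the original data) and $\Delta f_s$ for the sensitivity of SMOTE, $f=f_S$. **Theorem (SMOTE sensitivity reduction).** Whenever the two maxima exist, $$\Delta f_s<\Delta f .$$ Both maxima exist if $\Theta$ is finite and non-empty, in particular if $\Theta=\{(\mu,\Sigma)\}$. -/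

import Mathlib

open MeasureTheory ProbabilityTheory
open scoped ENNReal

noncomputable section

namespace SmoteDP

/-- A record with `d` real attributes, with the Euclidean norm. -/
abbrev Record (d : ℕ) : Type := EuclideanSpace ℝ (Fin d)

/-- A dataset of `n` records. -/
abbrev Dataset (n d : ℕ) : Type := Fin n → Record d

/-- `Closer x i k j`: seen from the record `x i`, the record `x k` comes before the record `x j`
in the order of increasing distance (equal distances are ordered by the index). -/
def Closer {n d : ℕ} (x : Dataset n d) (i k j : Fin n) : Prop :=
  dist (x k) (x i) < dist (x j) (x i) ∨ (dist (x k) (x i) = dist (x j) (x i) ∧ k < j)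

open Classical in
/-- The (indices of the) `K` nearest neighbours of `x i` among the other records of `x`:
those `j ≠ i` that are preceded by fewer than `K` other records. -/
def nearest {n d : ℕ} (K : ℕ) (x : Dataset n d) (i : Fin n) : Finset (Fin n) :=
  {j | j ≠ i ∧ Finset.card {k | k ≠ i ∧ Closer x i k j} < K}

/-- The uniform distribution on the segment from `a` to `b`: the law of `a + w (b - a)` with `w`
uniform in `[0, 1]`. -/
def segmentLaw {d : ℕ} (a b : Record d) : Measure (Record d) :=
  (volume.restrict (Set.Icc (0 : ℝ) 1)).map fun w => a + w • (b - a)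

/-- The law of one SMOTE sample from the dataset `x`: choose a base record `x i` uniformly, then
one of its `K` nearest neighbours `x j` uniformly, and interpolate with a uniform weight. -/
def smoteSample {n d : ℕ} (K : ℕ) (x : Dataset n d) : Measure (Record d) :=
  (n : ℝ≥0∞)⁻¹ • ∑ i, ((nearest K x i).card : ℝ≥0∞)⁻¹ •
    ∑ j ∈ nearest K x i, segmentLaw (x i) (x j)

lemma segmentLaw_apply {d : ℕ} (a b : Record d) {s : Set (Record d)} (hs : MeasurableSet s) :
    segmentLaw a b s =
      volume.restrict (Set.Icc (0 : ℝ) 1) ((fun w : ℝ => a + w • (b - a)) ⁻¹' s) :=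
  Measure.map_apply (by fun_prop) hs

instance {d : ℕ} (a b : Record d) : IsProbabilityMeasure (segmentLaw a b) := by
  have : IsProbabilityMeasure (volume.restrict (Set.Icc (0 : ℝ) 1)) := ⟨by simp⟩
  exact Measure.isProbabilityMeasure_map (by fun_prop)

instance {n d : ℕ} (K : ℕ) (x : Dataset n d) : IsFiniteMeasure (smoteSample K x) := by
  refine ⟨lt_of_le_of_lt (b := 1) ?_ (by simp)⟩
  simp only [smoteSample, Measure.smul_apply, Measure.coe_finsetSum, Finset.sum_apply,
    measure_univ, smul_eq_mul, Finset.sum_const, nsmul_eq_mul, mul_one]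
  calc (n : ℝ≥0∞)⁻¹ * ∑ i, ((nearest K x i).card : ℝ≥0∞)⁻¹ * ((nearest K x i).card : ℝ≥0∞)
      ≤ (n : ℝ≥0∞)⁻¹ * ∑ _i : Fin n, 1 := by
        gcongr
        exact ENNReal.inv_mul_le_one _
    _ ≤ 1 := by simp [ENNReal.inv_mul_le_one]

lemma measurableSet_closer {n d : ℕ} (i k j : Fin n) :
    MeasurableSet {x : Dataset n d | Closer x i k j} := by
  have hd : ∀ k : Fin n, Measurable fun x : Dataset n d => dist (x k) (x i) := fun k => by
    fun_prop
  exact (measurableSet_lt (hd k) (hd j)).union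
    ((measurableSet_eq_fun (hd k) (hd j)).inter (MeasurableSet.const _))

lemma measurableSet_mem_nearest {n d : ℕ} (K : ℕ) (i j : Fin n) :
    MeasurableSet {x : Dataset n d | j ∈ nearest K x i} := by
  classical
  have h : Measurable fun x : Dataset n d =>
      ∑ k : Fin n, if k ≠ i ∧ Closer x i k j then 1 else 0 := by
    refine Finset.measurable_sum _ fun k _ => ?_
    exact Measurable.ite ((MeasurableSet.const _).inter (measurableSet_closer i k j))
      measurable_const measurable_const
  have h2 : {x : Dataset n d | j ∈ nearest K x i} =
      {_x | j ≠ i} ∩ {x | (∑ k : Fin n, if k ≠ i ∧ Closer x i k j then 1 else 0) < K} := by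
    ext x
    simp only [nearest, Finset.mem_filter, Finset.mem_univ, true_and, Set.mem_ofPred_eq,
      Set.mem_inter_iff, Finset.card_filter]
  rw [h2]
  exact (MeasurableSet.const _).inter (measurableSet_lt h measurable_const)

lemma measurable_smoteSample {n d : ℕ} (K : ℕ) :
    Measurable (smoteSample K : Dataset n d → Measure (Record d)) := by
  classical
  refine Measure.measurable_of_measurable_coe _ fun s hs => ?_
  have hseg : ∀ i j : Fin n, Measurable fun x : Dataset n d => segmentLaw (x i) (x j) s := by
    intro i j
    simp_rw [segmentLaw_apply _ _ hs]
    have hf : Measurable fun p : Dataset n d × ℝ => p.1 i + p.2 • (p.1 j - p.1 i) := by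
      fun_prop
    exact measurable_measure_prodMk_left (hf hs)
  have hcard : ∀ i : Fin n, Measurable fun x : Dataset n d =>
      ((nearest K x i).card : ℝ≥0∞)⁻¹ := by
    intro i
    have h : ∀ x : Dataset n d, ((nearest K x i).card : ℝ≥0∞) =
        ∑ j : Fin n, if j ∈ nearest K x i then 1 else 0 := by
      intro x; simp
    simp_rw [h]
    exact (Finset.measurable_sum _ fun j _ => Measurable.ite (measurableSet_mem_nearest K i j)
      measurable_const measurable_const).inv
  have hsum : ∀ i : Fin n, Measurable fun x : Dataset n d =>
      ∑ j ∈ nearest K x i, segmentLaw (x i) (x j) s := by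
    intro i
    have h : ∀ x : Dataset n d, ∑ j ∈ nearest K x i, segmentLaw (x i) (x j) s =
        ∑ j : Fin n, if j ∈ nearest K x i then segmentLaw (x i) (x j) s else 0 := by
      intro x; simp [Finset.sum_ite_mem]
    simp_rw [h]
    exact Finset.measurable_sum _ fun j _ => Measurable.ite (measurableSet_mem_nearest K i j)
      (hseg i j) measurable_const
  simp only [smoteSample, Measure.smul_apply, Measure.coe_finsetSum, Finset.sum_apply,
    smul_eq_mul]
  exact (Finset.measurable_sum _ fun i _ => (hcard i).mul (hsum i)).const_mul _

lemma measurable_pi_smoteSample {n d : ℕ} (K m : ℕ) :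
    Measurable fun x : Dataset n d => Measure.pi fun _ : Fin m => smoteSample K x := by
  have hrow : ∀ s : Set (Record d), MeasurableSet s →
      Measurable fun x : Dataset n d => smoteSample K x s := fun s hs =>
    (Measure.measurable_coe hs).comp (measurable_smoteSample K)
  refine Measurable.measure_of_isPiSystem generateFrom_pi.symm isPiSystem_pi ?_ ?_
  · rintro _ ⟨s, hs, rfl⟩
    simp_rw [Measure.pi_pi]
    exact Finset.measurable_prod _ fun r _ => hrow _ (hs r (Set.mem_univ _))
  · simp_rw [Measure.pi_univ]
    exact Finset.measurable_prod _ fun r _ => hrow _ MeasurableSet.univ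

/-- SMOTE with `K` neighbours as a generative model: it turns a dataset of `n` records into a
random dataset of `m` records, which are independent SMOTE samples from the given dataset. -/
def smote (n m d K : ℕ) : Kernel (Dataset n d) (Dataset m d) where
  toFun x := Measure.pi fun _ => smoteSample K x
  measurable' := measurable_pi_smoteSample K m

/-- The law of a uniformly chosen record of a random dataset with law `P`. -/
def recordLaw {m d : ℕ} (P : Measure (Dataset m d)) : Measure (Record d) :=
  (m : ℝ≥0∞)⁻¹ • ∑ r, P.map fun x => x r

/-- The mean vector of (a record of) a random dataset with law `P`. -/
def dataMean {m d : ℕ} (P : Measure (Dataset m d)) : Record d :=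
  ∫ z, z ∂(recordLaw P)

/-- The covariance matrix of (a record of) a random dataset with law `P`. -/
def dataCov {m d : ℕ} (P : Measure (Dataset m d)) : Matrix (Fin d) (Fin d) ℝ :=
  Matrix.of fun a b => cov[fun z => z a, fun z => z b; recordLaw P]

/-- The law of a dataset `X ∼ N(μ, Σ)` of `n` independent records; `θ = (μ, Σ)`. -/
def gaussianData (n : ℕ) {d : ℕ} (θ : Record d × Matrix (Fin d) (Fin d) ℝ) :
    Measure (Dataset n d) :=
  Measure.pi fun _ => multivariateGaussian θ.1 θ.2

open Classical in
/-- `π` is the joint law of two neighbouring Gaussian datasets `X ∼ N(θ)`, `X' ∼ N(θ')`: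
almost surely they differ in at most one record. -/
def IsNeighbouring {n d : ℕ} (θ θ' : Record d × Matrix (Fin d) (Fin d) ℝ)
    (π : Measure (Dataset n d × Dataset n d)) : Prop :=
  π.fst = gaussianData n θ ∧ π.snd = gaussianData n θ' ∧ ∀ᵐ p ∂π, hammingDist p.1 p.2 ≤ 1

/-- The numbers `‖μ_{f(X)} - μ_{f(X')}‖ + tr (Σ_{f(X)} + Σ_{f(X')})`, where `(X, X')` runs through
the pairs of neighbouring Gaussian datasets with parameters in `Θ` and `f` is a generative model.
The sensitivity of `f` is the maximum of this set. -/
def sensitivityValues {n m d : ℕ} (Θ : Set (Record d × Matrix (Fin d) (Fin d) ℝ))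
    (f : Kernel (Dataset n d) (Dataset m d)) : Set ℝ :=
  {v | ∃ θ ∈ Θ, ∃ θ' ∈ Θ, ∃ π : Measure (Dataset n d × Dataset n d), IsNeighbouring θ θ' π ∧
    v = ‖dataMean (π.fst.bind f) - dataMean (π.snd.bind f)‖ +
      (dataCov (π.fst.bind f) + dataCov (π.snd.bind f)).trace}

/-- `Δ` is the sensitivity of the generative model `f`. -/
def IsSensitivity {n m d : ℕ} (Θ : Set (Record d × Matrix (Fin d) (Fin d) ℝ))
    (f : Kernel (Dataset n d) (Dataset m d)) (Δ : ℝ) : Prop :=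
  IsGreatest (sensitivityValues Θ f) Δ

end SmoteDP

end

/-! The sensitivity value of a neighbouring pair depends only on the two marginal laws, hence only
on `(θ, θ')`. It therefore suffices that SMOTE preserves the mean of Gaussian data and strictly
lowers the trace of its covariance; the pair that attains the SMOTE maximum then has a strictly
larger value for the identity.

The mean is preserved because the data law and the SMOTE construction both commute with the
reflection in `μ` (`smoteSample_reflection`).

For the trace, integrating over the weight gives half the squared distances of both endpoints from
`μ`, minus `‖x i - x j‖ ^ 2 / 6` (`integral_norm_segment_sq`). The last term has positive mean,
which makes the inequality strict. It remains to see that a selected neighbour is on average no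
farther from `μ` than its base record (`lintegral_nearest_le`).

This is a rearrangement argument along each principal axis. Exchange the coordinates of base and
neighbour on that axis: their distance is unchanged, but the ball that competing neighbours must
enter has a new centre. By unimodality the ball has less Gaussian mass when its centre has the
larger absolute coordinate (`pi_closerSet_le`), so there are fewer competitors and selection is more
likely (`neighbourProb_le_swap`). Selection thus favours the larger coordinate in the base
(`lintegral_mul_le_of_swap`). -/

namespace SmoteDP

/-! ### Resampling a coordinate and counting independent successes -/

section ProductMeasures

open Classical in
lemma measurable_card_filter {ι : Type*} {X : ι → Type*} [∀ i, MeasurableSpace (X i)]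
    (A : ∀ i, Set (X i)) (hA : ∀ i, MeasurableSet (A i))
    (s : Finset ι) :
    Measurable fun x : ∀ i, X i => (s.filter fun k => x k ∈ A k).card := by
  simp only [Finset.card_filter]
  refine Finset.measurable_sum _ fun k _ => ?_
  exact Measurable.ite (measurable_pi_apply k (hA k)) measurable_const measurable_const

variable {ι : Type*} [Fintype ι] [DecidableEq ι] {X : ι → Type*} [∀ i, MeasurableSpace (X i)]
  (ν : ∀ i, Measure (X i)) [∀ i, IsProbabilityMeasure (ν i)]

/-- Resampling one coordinate of a product probability measure preserves the measure. -/
lemma measurePreserving_update (k : ι) :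
    MeasurePreserving (fun p : (∀ i, X i) × X k => Function.update p.1 k p.2)
      ((Measure.pi ν).prod (ν k)) (Measure.pi ν) := by
  refine ⟨measurable_update'.comp measurable_id, ?_⟩
  refine (Measure.pi_eq fun s hs => ?_).symm
  rw [Measure.map_apply measurable_update' (MeasurableSet.univ_pi hs)]
  have h : (fun p : (∀ i, X i) × X k => Function.update p.1 k p.2) ⁻¹' Set.univ.pi s =
      Set.univ.pi (Function.update s k Set.univ) ×ˢ s k := by
    ext ⟨x, t⟩
    simp only [Set.mem_preimage, Set.mem_univ_pi, Set.mem_prod]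
    constructor
    · intro h
      refine ⟨fun i => ?_, by simpa using h k⟩
      rcases eq_or_ne i k with rfl | hi
      · simp
      · simpa [hi] using h i
    · rintro ⟨h, ht⟩ i
      rcases eq_or_ne i k with rfl | hi
      · simpa using ht
      · simpa [hi] using h i
  rw [h, Measure.prod_prod, Measure.pi_pi, ← Finset.mul_prod_erase _ _ (Finset.mem_univ k),
    ← Finset.mul_prod_erase (Finset.univ) (fun i => ν i (s i)) (Finset.mem_univ k)]
  simp only [Function.update_self, measure_univ, one_mul]
  rw [mul_comm]
  congr 1
  refine Finset.prod_congr rfl fun i hi => ?_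
  rw [Function.update_of_ne (Finset.ne_of_mem_erase hi)]

-- Condition on trial `l`, resampled independently of the others: a success uses up one of the
-- allowed successes, a failure uses none.
open Classical in
lemma pi_card_insert_lt (A : ∀ i, Set (X i)) (hA : ∀ i, MeasurableSet (A i)) {s : Finset ι} {l : ι}
    (hl : l ∉ s) (K : ℕ) :
    (Measure.pi ν).real {x | ((insert l s).filter fun k => x k ∈ A k).card < K} =
      (ν l).real (A l) * (Measure.pi ν).real {x | (s.filter fun k => x k ∈ A k).card + 1 < K} +
      (1 - (ν l).real (A l)) *
        (Measure.pi ν).real {x | (s.filter fun k => x k ∈ A k).card < K} := by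
  have hc := measurable_card_filter A hA
  have hm : ∀ s : Finset ι, MeasurableSet {x : ∀ i, X i | (s.filter fun k => x k ∈ A k).card < K} :=
    fun s => measurableSet_lt (hc s) measurable_const
  have hpre : (fun p : (∀ i, X i) × X l => Function.update p.1 l p.2) ⁻¹'
      {x | ((insert l s).filter fun k => x k ∈ A k).card < K} =
      {x | (s.filter fun k => x k ∈ A k).card + 1 < K} ×ˢ A l ∪
      {x | (s.filter fun k => x k ∈ A k).card < K} ×ˢ (A l)ᶜ := by
    ext ⟨x, t⟩
    have hs : (s.filter fun k => Function.update x l t k ∈ A k) =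
        s.filter fun k => x k ∈ A k := by
      refine Finset.filter_congr fun k hk => ?_
      rw [Function.update_of_ne (ne_of_mem_of_not_mem hk hl)]
    simp only [Set.mem_preimage, Set.mem_ofPred_eq, Finset.filter_insert, hs,
      Function.update_self, Set.mem_union, Set.mem_prod, Set.mem_compl_iff]
    by_cases ht : t ∈ A l
    · simp [ht, Finset.card_insert_of_notMem, hl]
    · simp [ht]
  rw [← (measurePreserving_update ν l).measureReal_preimage (hm _).nullMeasurableSet, hpre,
    measureReal_union _ ((hm s).prod (hA l).compl), measureReal_prod_prod, measureReal_prod_prod,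
    probReal_compl_eq_one_sub (hA l)]
  · ring
  · exact Set.disjoint_left.2 fun p hp hp' => hp'.2 hp.2

open Classical in
/-- For independent trials, larger success probabilities make fewer than `K` successes less
likely. -/
lemma pi_card_filter_lt_mono (A B : ∀ i, Set (X i)) (hA : ∀ i, MeasurableSet (A i))
    (hB : ∀ i, MeasurableSet (B i)) (s : Finset ι) (h : ∀ k ∈ s, (ν k).real (A k) ≤ (ν k).real (B k))
    (K : ℕ) :
    (Measure.pi ν).real {x | (s.filter fun k => x k ∈ B k).card < K} ≤
      (Measure.pi ν).real {x | (s.filter fun k => x k ∈ A k).card < K} := by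
  induction s using Finset.induction_on generalizing K with
  | empty => simp
  | insert l s hl ih =>
    have ih' := ih fun k hk => h k (Finset.mem_insert_of_mem hk)
    have hlt := h l (Finset.mem_insert_self l s)
    rw [pi_card_insert_lt ν A hA hl, pi_card_insert_lt ν B hB hl]
    have h1 := ih' K
    -- For `K = 0` the truncated `K - 1` is harmless: both events are empty.
    have h2 := ih' (K - 1)
    simp only [Nat.lt_sub_iff_add_lt] at h2
    have h3 : (Measure.pi ν).real {x | (s.filter fun k => x k ∈ A k).card + 1 < K} ≤
        (Measure.pi ν).real {x | (s.filter fun k => x k ∈ A k).card < K} :=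
      measureReal_mono fun x hx => Nat.lt_of_succ_lt hx
    have hb0 : 0 ≤ (ν l).real (B l) := measureReal_nonneg
    have hb1 : (ν l).real (B l) ≤ 1 := measureReal_le_one
    -- Replace `B` by `A` in both conditional terms, keeping the weight of `B l`; then lowering the
    -- success weight to that of `A l` shifts mass to the larger term.
    nlinarith [mul_le_mul_of_nonneg_left h2 hb0,
      mul_le_mul_of_nonneg_left h1 (sub_nonneg.2 hb1),
      mul_nonneg (sub_nonneg.2 hlt) (sub_nonneg.2 h3)]

end ProductMeasures

/-! ### Unimodality of the one-dimensional Gaussian -/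

section Unimodality

lemma gaussianPDFReal_zero_le_of_abs_le (v : NNReal) {s t : ℝ} (h : |s| ≤ |t|) :
    gaussianPDFReal 0 v t ≤ gaussianPDFReal 0 v s := by
  have := sq_le_sq.2 h
  simp only [gaussianPDFReal, sub_zero]
  gcongr

lemma gaussianReal_zero_Icc_abs (v : NNReal) (c r : ℝ) :
    gaussianReal 0 v (Set.Icc (|c| - r) (|c| + r)) = gaussianReal 0 v (Set.Icc (c - r) (c + r)) := by
  rcases abs_cases c with ⟨h, _⟩ | ⟨h, _⟩
  · rw [h]
  · have hm := gaussianReal_map_neg (μ := 0) (v := v)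
    rw [neg_zero] at hm
    conv_lhs => rw [← hm]
    rw [Measure.map_apply measurable_neg measurableSet_Icc, h]
    congr 1
    ext t
    simp only [Set.mem_preimage, Set.mem_Icc]
    constructor <;> rintro ⟨h1, h2⟩ <;> constructor <;> linarith

/-- The mass that a centred Gaussian puts on an interval decreases as the centre of the interval
moves away from the origin. -/
lemma gaussianReal_zero_Icc_le {v : NNReal} (hv : v ≠ 0) {c c' r : ℝ} (hr : 0 ≤ r)
    (h : |c| ≤ |c'|) :
    gaussianReal 0 v (Set.Icc (c' - r) (c' + r)) ≤ gaussianReal 0 v (Set.Icc (c - r) (c + r)) := by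
  rw [← gaussianReal_zero_Icc_abs v c, ← gaussianReal_zero_Icc_abs v c']
  have h0 := abs_nonneg c
  generalize |c| = a at *
  generalize |c'| = b at *
  rw [gaussianReal_apply_eq_integral _ hv, gaussianReal_apply_eq_integral _ hv]
  refine ENNReal.ofReal_le_ofReal ?_
  have hi : ∀ p q : ℝ, IntervalIntegrable (gaussianPDFReal 0 v) volume p q := fun p q =>
    (integrable_gaussianPDFReal 0 v).intervalIntegrable
  rw [integral_Icc_eq_integral_Ioc, integral_Icc_eq_integral_Ioc,
    ← intervalIntegral.integral_of_le (by linarith), ← intervalIntegral.integral_of_le (by linarith)]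
  -- Moving the interval from `a` to `b` gains `[a + r, b + r]` and loses `[a - r, b - r]`.
  have e1 : (∫ x in (b - r)..(b + r), gaussianPDFReal 0 v x) -
      ∫ x in (a - r)..(a + r), gaussianPDFReal 0 v x =
      (∫ x in (a + r)..(b + r), gaussianPDFReal 0 v x) -
      ∫ x in (a - r)..(b - r), gaussianPDFReal 0 v x := by
    have h1 := intervalIntegral.integral_add_adjacent_intervals (hi (a - r) (b - r)) (hi (b - r) (b + r))
    have h2 := intervalIntegral.integral_add_adjacent_intervals (hi (a - r) (a + r)) (hi (a + r) (b + r))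
    linarith
  -- Both pieces are translates of `[a, b]`, and `|t - r| ≤ t + r` for nonnegative `t` and `r`.
  have e2 : (∫ x in (a + r)..(b + r), gaussianPDFReal 0 v x) ≤
      ∫ x in (a - r)..(b - r), gaussianPDFReal 0 v x := by
    rw [← intervalIntegral.integral_comp_add_right, ← intervalIntegral.integral_comp_sub_right]
    refine intervalIntegral.integral_mono_on h ?_ ?_ fun t ht => ?_
    · exact ((integrable_gaussianPDFReal 0 v).comp_add_right r).intervalIntegrable
    · exact ((integrable_gaussianPDFReal 0 v).comp_sub_right r).intervalIntegrable
    · refine gaussianPDFReal_zero_le_of_abs_le v ?_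
      have := ht.1
      rw [abs_of_nonneg (show 0 ≤ t + r by linarith), abs_le]
      constructor <;> linarith
  linarith

lemma gaussianReal_zero_sq_le {v : NNReal} (hv : v ≠ 0) {c c' : ℝ} (h : |c| ≤ |c'|) (ρ : ℝ) :
    gaussianReal 0 v {t | (t - c') ^ 2 ≤ ρ} ≤ gaussianReal 0 v {t | (t - c) ^ 2 ≤ ρ} := by
  rcases lt_or_ge ρ 0 with hρ | hρ
  · have : {t | (t - c') ^ 2 ≤ ρ} = ∅ := by
      ext t
      simpa using hρ.trans_le (sq_nonneg _)
    simp [this]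
  · have he : ∀ c : ℝ, {t | (t - c) ^ 2 ≤ ρ} = Set.Icc (c - √ρ) (c + √ρ) := fun c => by
      ext t
      rw [Set.mem_ofPred_eq, Real.sq_le hρ, Set.mem_Icc]
      constructor <;> rintro ⟨h1, h2⟩ <;> constructor <;> linarith
    rw [he, he]
    exact gaussianReal_zero_Icc_le hv (Real.sqrt_nonneg _) h

/-- A one-dimensional Anderson inequality, for closed, open and degenerate intervals at once. -/
lemma gaussianReal_zero_sq_mem_le (v : NNReal) {c c' : ℝ} (h : |c| ≤ |c'|) {J : Set ℝ}
    (hJ : IsLowerSet J) :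
    gaussianReal 0 v {t | (t - c') ^ 2 ∈ J} ≤ gaussianReal 0 v {t | (t - c) ^ 2 ∈ J} := by
  have hJm : MeasurableSet J := hJ.ordConnected.measurableSet
  have hm : ∀ c : ℝ, MeasurableSet {t | (t - c) ^ 2 ∈ J} := fun c =>
    (show Measurable fun t : ℝ => (t - c) ^ 2 by fun_prop) hJm
  -- A semidefinite covariance may have zero eigenvalues, so the Dirac case is needed.
  rcases eq_or_ne v 0 with rfl | hv
  · rw [gaussianReal_zero_var, Measure.dirac_apply' _ (hm c), Measure.dirac_apply' _ (hm c')]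
    by_cases h0 : (0 : ℝ) ∈ {t | (t - c') ^ 2 ∈ J}
    · have h1 : (0 : ℝ) ∈ {t | (t - c) ^ 2 ∈ J} := hJ (by simpa using sq_le_sq.2 h) h0
      simp [h0, h1]
    · simp [h0]
  rcases J.eq_empty_or_nonempty with rfl | hne
  · simp
  by_cases hb : BddAbove J
  swap
  · have : J = Set.univ := Set.eq_univ_of_forall fun u => by
      obtain ⟨w, hw, huw⟩ := not_bddAbove_iff.1 hb u
      exact hJ huw.le hw
    simp [this]
  -- `J` differs from the closed half-line up to `sSup J` at most in the endpoint, which at most two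
  -- values of `t` reach.
  have hna : gaussianReal 0 v {t | (t - c) ^ 2 = sSup J} = 0 := by
    have := nullSingletonClass_gaussianReal (μ := 0) hv
    refine Set.Finite.measure_zero ?_ _
    refine (Set.toFinite {c + √(sSup J), c - √(sSup J)}).subset fun t ht => ?_
    have h2 : √(sSup J) = |t - c| := by rw [← show (t - c) ^ 2 = sSup J from ht, Real.sqrt_sq_eq_abs]
    rw [h2]
    rcases abs_cases (t - c) with ⟨h3, _⟩ | ⟨h3, _⟩ <;> rw [h3] <;> simp
  calc gaussianReal 0 v {t | (t - c') ^ 2 ∈ J}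
      ≤ gaussianReal 0 v {t | (t - c') ^ 2 ≤ sSup J} :=
        measure_mono fun t ht => le_csSup hb ht
    _ ≤ gaussianReal 0 v {t | (t - c) ^ 2 ≤ sSup J} := gaussianReal_zero_sq_le hv h _
    _ ≤ gaussianReal 0 v ({t | (t - c) ^ 2 ∈ J} ∪ {t | (t - c) ^ 2 = sSup J}) := by
        refine measure_mono fun t ht => ?_
        rcases (show (t - c) ^ 2 ≤ sSup J from ht).lt_or_eq with h1 | h1
        · obtain ⟨w, hw, hlt⟩ := exists_lt_of_lt_csSup hne h1
          exact Or.inl (hJ hlt.le hw)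
        · exact Or.inr h1
    _ ≤ gaussianReal 0 v {t | (t - c) ^ 2 ∈ J} := by
        refine (measure_union_le _ _).trans ?_
        rw [hna, add_zero]

end Unimodality

/-! ### Exchanging one coordinate of two independent points -/

section Resampling

variable {ι : Type*} [Fintype ι] [DecidableEq ι] {X : ι → Type*} [∀ i, MeasurableSpace (X i)]
  (ν : ∀ i, Measure (X i)) [∀ i, IsProbabilityMeasure (ν i)]

lemma lintegral_pi_update (k : ι) {f : (∀ i, X i) → ℝ≥0∞} (hf : Measurable f) :
    ∫⁻ x, f x ∂(Measure.pi ν) =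
      ∫⁻ t, ∫⁻ x, f (Function.update x k t) ∂(Measure.pi ν) ∂(ν k) := by
  rw [← (measurePreserving_update ν k).lintegral_comp hf]
  exact lintegral_prod_symm' _ (hf.comp measurable_update')

lemma measurable_lintegral_lintegral_update (k : ι) {F : (∀ i, X i) → (∀ i, X i) → ℝ≥0∞}
    (hF : Measurable (Function.uncurry F)) :
    Measurable (Function.uncurry fun s t => ∫⁻ a, ∫⁻ b, F (Function.update a k s)
      (Function.update b k t) ∂(Measure.pi ν) ∂(Measure.pi ν)) := by
  have h : Measurable fun r : ((X k × X k) × (∀ i, X i)) × (∀ i, X i) =>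
      F (Function.update r.1.2 k r.1.1.1) (Function.update r.2 k r.1.1.2) := by
    refine hF.comp (Measurable.prodMk ?_ ?_)
    · exact measurable_update'.comp (g := fun p : (∀ i, X i) × X k => Function.update p.1 k p.2)
        (f := fun r : ((X k × X k) × (∀ i, X i)) × (∀ i, X i) => (r.1.2, r.1.1.1)) (by fun_prop)
    · exact measurable_update'.comp (g := fun p : (∀ i, X i) × X k => Function.update p.1 k p.2)
        (f := fun r : ((X k × X k) × (∀ i, X i)) × (∀ i, X i) => (r.2, r.1.1.2)) (by fun_prop)
  exact h.lintegral_prod_right'.lintegral_prod_right'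

/-- This isolates the `k`-th coordinates `s`, `t` of two independent points, so that they can be
exchanged while all other coordinates stay fixed. -/
lemma lintegral_pi_update_update (k : ι) {F : (∀ i, X i) → (∀ i, X i) → ℝ≥0∞}
    (hF : Measurable (Function.uncurry F)) :
    ∫⁻ a, ∫⁻ b, F a b ∂(Measure.pi ν) ∂(Measure.pi ν) =
      ∫⁻ s, ∫⁻ t, ∫⁻ a, ∫⁻ b, F (Function.update a k s) (Function.update b k t)
        ∂(Measure.pi ν) ∂(Measure.pi ν) ∂(ν k) ∂(ν k) := by
  refine (lintegral_pi_update ν k (Measurable.lintegral_prod_right' hF)).trans ?_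
  refine lintegral_congr fun s => ?_
  have h1 : ∀ a : ∀ i, X i, ∫⁻ b, F (Function.update a k s) b ∂(Measure.pi ν) =
      ∫⁻ t, ∫⁻ b, F (Function.update a k s) (Function.update b k t) ∂(Measure.pi ν) ∂(ν k) :=
    fun a => lintegral_pi_update ν k (hF.comp measurable_prodMk_left)
  simp_rw [Function.uncurry_apply_pair, h1]
  refine lintegral_lintegral_swap (Measurable.aemeasurable ?_)
  have h : Measurable fun r : ((∀ i, X i) × X k) × (∀ i, X i) =>
      F (Function.update r.1.1 k s) (Function.update r.2 k r.1.2) := by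
    refine hF.comp (Measurable.prodMk ?_ ?_)
    · exact measurable_update_left.comp (by fun_prop)
    · exact measurable_update'.comp (g := fun p : (∀ i, X i) × X k => Function.update p.1 k p.2)
        (f := fun r : ((∀ i, X i) × X k) × (∀ i, X i) => (r.2, r.1.2)) (by fun_prop)
  exact h.lintegral_prod_right'

/-- A rearrangement inequality: a weight `Q s t` which is larger with the larger argument
first prefers the second argument to be small. -/
lemma lintegral_mul_le_of_swap {Y : Type*} [MeasurableSpace Y] (γ : Measure Y) [SFinite γ]
    {Q : Y → Y → ℝ≥0∞} (hQ : Measurable (Function.uncurry Q)) {g : Y → ℝ≥0∞} (hg : Measurable g)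
    (h : ∀ s t, g s ≤ g t → Q s t ≤ Q t s) :
    ∫⁻ s, ∫⁻ t, Q s t * g t ∂γ ∂γ ≤ ∫⁻ s, ∫⁻ t, Q s t * g s ∂γ ∂γ := by
  have hg1 : Measurable fun p : Y × Y => g p.1 := hg.comp measurable_fst
  have hg2 : Measurable fun p : Y × Y => g p.2 := hg.comp measurable_snd
  have e1 : ∫⁻ s, ∫⁻ t, Q s t * g t ∂γ ∂γ = ∫⁻ s, ∫⁻ t, Q t s * g s ∂γ ∂γ :=
    lintegral_lintegral_swap (hQ.mul hg2).aemeasurable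
  have e2 : ∫⁻ s, ∫⁻ t, Q s t * g s ∂γ ∂γ = ∫⁻ s, ∫⁻ t, Q t s * g t ∂γ ∂γ :=
    lintegral_lintegral_swap (hQ.mul hg1).aemeasurable
  have hadd : ∀ A B : Y → Y → ℝ≥0∞, Measurable (Function.uncurry A) →
      ∫⁻ s, ∫⁻ t, A s t ∂γ ∂γ + ∫⁻ s, ∫⁻ t, B s t ∂γ ∂γ = ∫⁻ s, ∫⁻ t, A s t + B s t ∂γ ∂γ := by
    intro A B hA
    refine (lintegral_add_left (Measurable.lintegral_prod_right' hA) _).symm.trans ?_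
    refine lintegral_congr fun s => ?_
    exact (lintegral_add_left (hA.comp measurable_prodMk_left) _).symm
  have hrearr : ∀ {a b c d : ℝ≥0∞}, a ≤ b → c ≤ d → a * d + b * c ≤ a * c + b * d := by
    intro a b c d hab hcd
    obtain ⟨e, rfl⟩ := exists_add_of_le hab
    obtain ⟨f, rfl⟩ := exists_add_of_le hcd
    calc a * (c + f) + (a + e) * c ≤ a * (c + f) + (a + e) * c + e * f := le_self_add
      _ = a * c + (a + e) * (c + f) := by ring
  -- Doubling both sides and renaming variables in one copy symmetrizes the integrands; the
  -- inequality then holds pointwise by `hrearr`.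
  have key : ∫⁻ s, ∫⁻ t, Q s t * g t ∂γ ∂γ + ∫⁻ s, ∫⁻ t, Q s t * g t ∂γ ∂γ ≤
      ∫⁻ s, ∫⁻ t, Q s t * g s ∂γ ∂γ + ∫⁻ s, ∫⁻ t, Q s t * g s ∂γ ∂γ := by
    conv_lhs => rw [e1]
    conv_lhs => arg 1; rw [← e1]
    conv_rhs => arg 2; rw [e2]
    rw [hadd (fun s t => Q s t * g t) _ (hQ.mul hg2), hadd (fun s t => Q s t * g s) _ (hQ.mul hg1)]
    refine lintegral_mono fun s => lintegral_mono fun t => ?_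
    rcases le_total (g s) (g t) with hst | hst
    · simpa only [add_comm, mul_comm] using hrearr (h s t hst) hst
    · simpa only [add_comm, mul_comm] using hrearr (h t s hst) hst
  rw [← two_mul, ← two_mul] at key
  exact (ENNReal.mul_le_mul_iff_right (by simp) (by simp)).1 key

end Resampling

/-- The ball mass of a product of centred Gaussians decreases as one coordinate of the centre
moves away from the origin. -/
lemma pi_gaussianReal_sqDist_mem_le {ι : Type*} [Fintype ι] [DecidableEq ι] (v : ι → NNReal)
    {J : Set ℝ} (hJ : IsLowerSet J) (a : ι → ℝ) (l : ι) {s t : ℝ} (hst : |s| ≤ |t|) :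
    (Measure.pi fun k => gaussianReal 0 (v k))
        {z | ∑ k, (z k - Function.update a l t k) ^ 2 ∈ J} ≤
      (Measure.pi fun k => gaussianReal 0 (v k))
        {z | ∑ k, (z k - Function.update a l s k) ^ 2 ∈ J} := by
  have hJm : MeasurableSet J := hJ.ordConnected.measurableSet
  have hm : ∀ s : ℝ, MeasurableSet {z : ι → ℝ | ∑ k, (z k - Function.update a l s k) ^ 2 ∈ J} :=
    fun s => (show Measurable fun z : ι → ℝ => ∑ k, (z k - Function.update a l s k) ^ 2 by
      fun_prop) hJm
  -- With the other coordinates fixed, the event concerns one Gaussian variable and a translate of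
  -- `J`, again a lower set.
  have hsec : ∀ s : ℝ, ∀ x : ι → ℝ,
      Prod.mk x ⁻¹' ((fun p : (ι → ℝ) × ℝ => Function.update p.1 l p.2) ⁻¹'
        {z | ∑ k, (z k - Function.update a l s k) ^ 2 ∈ J}) =
      {u | (u - s) ^ 2 ∈ {w | w + ∑ k ∈ Finset.univ.erase l, (x k - a k) ^ 2 ∈ J}} := by
    intro s x
    ext u
    simp only [Set.mem_preimage, Set.mem_ofPred_eq]
    rw [← Finset.add_sum_erase _ _ (Finset.mem_univ l)]
    simp only [Function.update_self]
    rw [Finset.sum_congr rfl fun k hk => ?_]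
    rw [Function.update_of_ne (Finset.ne_of_mem_erase hk),
      Function.update_of_ne (Finset.ne_of_mem_erase hk)]
  have hmp := measurePreserving_update (fun k => gaussianReal 0 (v k)) l
  rw [← hmp.measure_preimage (hm s).nullMeasurableSet,
    ← hmp.measure_preimage (hm t).nullMeasurableSet,
    Measure.prod_apply (hmp.measurable (hm s)), Measure.prod_apply (hmp.measurable (hm t))]
  refine lintegral_mono fun x => ?_
  simp only [hsec]
  exact gaussianReal_zero_sq_mem_le _ hst fun p q hpq hp => hJ (by gcongr) hp

/-! ### Independent coordinates along the principal axes -/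

section PrincipalAxes

variable {d : ℕ}

/-- The point with coordinates `y` in the orthonormal frame `b` with origin `μ`. -/
noncomputable def ofAxes (μ : Record d) (b : OrthonormalBasis (Fin d) ℝ (Record d))
    (y : Fin d → ℝ) : Record d :=
  μ + ∑ k, y k • b k

lemma measurable_ofAxes (μ : Record d) (b : OrthonormalBasis (Fin d) ℝ (Record d)) :
    Measurable (ofAxes μ b) := by
  unfold ofAxes
  exact measurable_const.add (Finset.measurable_sum _ fun k _ => by fun_prop)

lemma norm_sum_smul_basis_sq (b : OrthonormalBasis (Fin d) ℝ (Record d)) (y : Fin d → ℝ) :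
    ‖∑ k, y k • b k‖ ^ 2 = ∑ k, y k ^ 2 := by
  rw [← b.sum_sq_inner_right]
  refine Finset.sum_congr rfl fun k _ => ?_
  rw [b.orthonormal.inner_right_fintype]

lemma norm_ofAxes_sub_sq (μ : Record d) (b : OrthonormalBasis (Fin d) ℝ (Record d))
    (y : Fin d → ℝ) : ‖ofAxes μ b y - μ‖ ^ 2 = ∑ k, y k ^ 2 := by
  rw [ofAxes, add_sub_cancel_left, norm_sum_smul_basis_sq]

lemma dist_ofAxes_sq (μ : Record d) (b : OrthonormalBasis (Fin d) ℝ (Record d))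
    (y z : Fin d → ℝ) : dist (ofAxes μ b y) (ofAxes μ b z) ^ 2 = ∑ k, (y k - z k) ^ 2 := by
  rw [dist_eq_norm, ofAxes, ofAxes, add_sub_add_left_eq_sub, ← Finset.sum_sub_distrib]
  simp_rw [← sub_smul]
  exact norm_sum_smul_basis_sq b _

lemma dotProduct_mulVec_eq_sum_eigenvalues {S : Matrix (Fin d) (Fin d) ℝ} (hS : S.IsHermitian)
    (t : Record d) :
    t.ofLp ⬝ᵥ S.mulVec t.ofLp =
      ∑ k, hS.eigenvalues k * inner ℝ (hS.eigenvectorBasis k) t ^ 2 := by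
  have h1 : t.ofLp ⬝ᵥ S.mulVec t.ofLp = inner ℝ t (WithLp.toLp 2 (S.mulVec t.ofLp)) := by
    simp [PiLp.inner_apply, dotProduct, mul_comm]
  have h2 : ∀ k, inner ℝ (hS.eigenvectorBasis k) (WithLp.toLp 2 (S.mulVec t.ofLp)) =
      hS.eigenvalues k * inner ℝ (hS.eigenvectorBasis k) t := by
    intro k
    have h3 : ∀ u w : Record d, inner ℝ u w = u.ofLp ⬝ᵥ w.ofLp := fun u w => by
      simp [PiLp.inner_apply, dotProduct, mul_comm]
    have hT : S.transpose = S := by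
      have := hS.eq
      rwa [Matrix.conjTranspose_eq_transpose_of_trivial] at this
    rw [h3, h3, Matrix.dotProduct_mulVec, ← Matrix.mulVec_transpose, hT,
      hS.mulVec_eigenvectorBasis, smul_dotProduct, smul_eq_mul]
  rw [h1, ← hS.eigenvectorBasis.sum_inner_mul_inner]
  refine Finset.sum_congr rfl fun k _ => ?_
  rw [h2, real_inner_comm]
  ring

/-- A multivariate Gaussian has independent centred Gaussian coordinates along its principal
axes. -/
lemma multivariateGaussian_eq_map_ofAxes (μ : Record d) {S : Matrix (Fin d) (Fin d) ℝ}
    (hS : S.PosSemidef) :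
    multivariateGaussian μ S =
      (Measure.pi fun k => gaussianReal 0 (hS.isHermitian.eigenvalues k).toNNReal).map
        (ofAxes μ hS.isHermitian.eigenvectorBasis) := by
  set b := hS.isHermitian.eigenvectorBasis with hb
  have hm := measurable_ofAxes μ b
  have : IsProbabilityMeasure
      ((Measure.pi fun k => gaussianReal 0 (hS.isHermitian.eigenvalues k).toNNReal).map
        (ofAxes μ b)) := Measure.isProbabilityMeasure_map hm.aemeasurable
  refine Measure.ext_of_charFun ?_
  ext t
  rw [charFun_multivariateGaussian hS, charFun_apply, integral_map hm.aemeasurable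
    (Measurable.aestronglyMeasurable (by fun_prop)),
    dotProduct_mulVec_eq_sum_eigenvalues hS.isHermitian]
  simp_rw [ofAxes, inner_add_left, sum_inner, Complex.ofReal_add, add_mul, Complex.exp_add,
    Complex.ofReal_sum, Finset.sum_mul, Complex.exp_sum]
  rw [integral_const_mul, integral_fintype_prod_eq_prod
    (f := fun i (x : ℝ) => Complex.exp ((inner ℝ (x • b i) t : ℝ) * Complex.I))]
  have hk : ∀ k, ∫ x, Complex.exp ((inner ℝ (x • b k) t : ℝ) * Complex.I)
      ∂(gaussianReal 0 (hS.isHermitian.eigenvalues k).toNNReal) =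
      Complex.exp (-(hS.isHermitian.eigenvalues k * inner ℝ (b k) t ^ 2 / 2 : ℝ)) := by
    intro k
    simp_rw [real_inner_smul_left, mul_comm _ (inner ℝ (b k) t), Complex.ofReal_mul,
      ← charFun_apply_real, charFun_gaussianReal]
    congr 1
    simp [Real.coe_toNNReal _ (hS.eigenvalues_nonneg k)]
  simp_rw [hk]
  rw [← Complex.exp_sum, ← Complex.exp_add, real_inner_comm]
  congr 1
  push_cast
  rw [Finset.sum_neg_distrib, Finset.sum_div]
  ring

end PrincipalAxes

/-! ### Second moments of nearest neighbours -/

section NeighbourMoments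

variable {n d : ℕ}

/-- The points which, as the record with index `k`, come before the record `b` with index `j` in
the order of increasing distance from `a`, in coordinates along an orthonormal frame. -/
def closerSet (j k : Fin n) (a b : Fin d → ℝ) : Set (Fin d → ℝ) :=
  {z | ∑ l, (z l - a l) ^ 2 ∈ {u : ℝ | u < ∑ l, (b l - a l) ^ 2 ∨
    (u = ∑ l, (b l - a l) ^ 2 ∧ k < j)}}

/-- Breaking ties by index makes the competitor region an open or a closed ball; lower sets of
squared distances cover both. -/
lemma isLowerSet_lt_or_eq (ρ : ℝ) (p : Prop) : IsLowerSet {u : ℝ | u < ρ ∨ (u = ρ ∧ p)} := by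
  rintro u w hwu (h | ⟨rfl, hp⟩)
  · exact Or.inl (hwu.trans_lt h)
  · exact hwu.lt_or_eq.imp id fun h => ⟨h, hp⟩

lemma measurableSet_closerSet (j k : Fin n) :
    MeasurableSet {p : ((Fin d → ℝ) × (Fin d → ℝ)) × (Fin d → ℝ) |
      p.2 ∈ closerSet j k p.1.1 p.1.2} := by
  have h1 : Measurable fun p : ((Fin d → ℝ) × (Fin d → ℝ)) × (Fin d → ℝ) =>
    ∑ l, (p.2 l - p.1.1 l) ^ 2 := by fun_prop
  have h2 : Measurable fun p : ((Fin d → ℝ) × (Fin d → ℝ)) × (Fin d → ℝ) =>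
    ∑ l, (p.1.2 l - p.1.1 l) ^ 2 := by fun_prop
  exact (measurableSet_lt h1 h2).union
    ((measurableSet_eq_fun h1 h2).inter (MeasurableSet.const _))

/-- The exchange leaves the radius, the distance from `a` to `b`, unchanged. Only the centre moves,
and it is farther from the origin when it carries `t`. -/
lemma pi_closerSet_le (v : Fin d → NNReal) (j k : Fin n) (a b : Fin d → ℝ) (l : Fin d) {s t : ℝ}
    (hst : |s| ≤ |t|) :
    (Measure.pi fun l => gaussianReal 0 (v l))
        (closerSet j k (Function.update a l t) (Function.update b l s)) ≤
      (Measure.pi fun l => gaussianReal 0 (v l))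
        (closerSet j k (Function.update a l s) (Function.update b l t)) := by
  have h : ∑ m, (Function.update b l s m - Function.update a l t m) ^ 2 =
      ∑ m, (Function.update b l t m - Function.update a l s m) ^ 2 := by
    refine Finset.sum_congr rfl fun m _ => ?_
    rcases eq_or_ne m l with rfl | hm
    · simp only [Function.update_self]
      ring
    · simp only [Function.update_of_ne hm]
  unfold closerSet
  rw [h]
  exact pi_gaussianReal_sqDist_mem_le v (isLowerSet_lt_or_eq _ _) a l hst

-- A record never precedes itself, so `j` can be dropped from the count. The remaining competitors
-- are independent trials once `y i` and `y j` are fixed.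
open Classical in
lemma mem_nearest_ofAxes (K : ℕ) (μ : Record d) (b : OrthonormalBasis (Fin d) ℝ (Record d))
    (y : Fin n → Fin d → ℝ) {i j : Fin n} (hij : i ≠ j) :
    j ∈ nearest K (fun k => ofAxes μ b (y k)) i ↔
      ((Finset.univ.filter fun k => k ≠ i ∧ k ≠ j).filter
        fun k => y k ∈ closerSet j k (y i) (y j)).card < K := by
  have h : ∀ k, Closer (fun k => ofAxes μ b (y k)) i k j ↔ y k ∈ closerSet j k (y i) (y j) := by
    intro k
    simp only [Closer, closerSet, Set.mem_ofPred_eq, ← dist_ofAxes_sq μ b]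
    rw [sq_lt_sq₀ dist_nonneg dist_nonneg, sq_eq_sq₀ dist_nonneg dist_nonneg]
  have hj : y j ∉ closerSet j j (y i) (y j) := by
    simp [closerSet]
  simp only [nearest, Finset.mem_filter, Finset.mem_univ, true_and, h, ne_eq, hij.symm,
    not_false_eq_true, Finset.filter_filter]
  refine iff_of_eq (congrArg (fun s : Finset (Fin n) => s.card < K)
    (Finset.filter_congr fun k _ => ?_))
  constructor
  · rintro ⟨h1, h2⟩
    exact ⟨⟨h1, fun h3 => hj (h3 ▸ h2)⟩, h2⟩
  · rintro ⟨⟨h1, _⟩, h2⟩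
    exact ⟨h1, h2⟩

open Classical in
/-- The probability that a record `b` with index `j` is among the `K` nearest neighbours of a
record `a` with index `i`, the other records being random. -/
noncomputable def neighbourProb (ρ : Measure (Fin d → ℝ)) (K : ℕ) (i j : Fin n)
    (a b : Fin d → ℝ) : ℝ≥0∞ :=
  (Measure.pi fun _ : Fin n => ρ)
    {y | ((Finset.univ.filter fun k => k ≠ i ∧ k ≠ j).filter
      fun k => y k ∈ closerSet j k a b).card < K}

open Classical in
lemma measurableSet_neighbour (K : ℕ) (i j : Fin n) :
    MeasurableSet {p : ((Fin d → ℝ) × (Fin d → ℝ)) × (Fin n → Fin d → ℝ) |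
      ((Finset.univ.filter fun k => k ≠ i ∧ k ≠ j).filter
        fun k => p.2 k ∈ closerSet j k p.1.1 p.1.2).card < K} := by
  refine measurableSet_lt ?_ measurable_const
  simp only [Finset.card_filter (fun k => _ ∈ closerSet j k _ _)]
  refine Finset.measurable_sum _ fun k _ => Measurable.ite ?_ measurable_const measurable_const
  exact (show Measurable fun p : ((Fin d → ℝ) × (Fin d → ℝ)) × (Fin n → Fin d → ℝ) =>
    (p.1, p.2 k) by fun_prop) (measurableSet_closerSet j k)

lemma measurable_neighbourProb (ρ : Measure (Fin d → ℝ)) [IsProbabilityMeasure ρ] (K : ℕ)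
    (i j : Fin n) : Measurable (Function.uncurry (neighbourProb ρ K i j)) :=
  measurable_measure_prodMk_left (measurableSet_neighbour K i j)

/-- Giving the base the larger coordinate lowers each competitor's chance to come first, so fewer
than `K` do so with larger probability. -/
lemma neighbourProb_le_swap (v : Fin d → NNReal) (K : ℕ) (i j : Fin n) (a b : Fin d → ℝ)
    (l : Fin d) {s t : ℝ} (hst : |s| ≤ |t|) :
    neighbourProb (Measure.pi fun l => gaussianReal 0 (v l)) K i j
        (Function.update a l s) (Function.update b l t) ≤
      neighbourProb (Measure.pi fun l => gaussianReal 0 (v l)) K i j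
        (Function.update a l t) (Function.update b l s) := by
  have hm : ∀ a b (k : Fin n), MeasurableSet (closerSet (d := d) j k a b) := fun a b k =>
    measurable_prodMk_left (x := (a, b)) (measurableSet_closerSet j k)
  refine (ENNReal.toReal_le_toReal (measure_ne_top _ _) (measure_ne_top _ _)).1 ?_
  refine pi_card_filter_lt_mono (fun _ : Fin n => Measure.pi fun l => gaussianReal 0 (v l))
    _ _ (hm _ _) (hm _ _) _ (fun k _ => ?_) K
  exact ENNReal.toReal_mono (measure_ne_top _ _) (pi_closerSet_le v j k a b l hst)

/-- Resample records `i` and `j` separately; the other records enter only through the selection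
event and integrate to `neighbourProb`. -/
lemma lintegral_neighbour (ρ : Measure (Fin d → ℝ)) [IsProbabilityMeasure ρ] (K : ℕ)
    (μ : Record d) (e : OrthonormalBasis (Fin d) ℝ (Record d))
    {i j : Fin n} (hij : i ≠ j) {G : (Fin d → ℝ) → (Fin d → ℝ) → ℝ≥0∞}
    (hG : Measurable (Function.uncurry G)) :
    ∫⁻ y in {y | j ∈ nearest K (fun k => ofAxes μ e (y k)) i}, G (y i) (y j)
        ∂(Measure.pi fun _ : Fin n => ρ) =
      ∫⁻ a, ∫⁻ b, neighbourProb ρ K i j a b * G a b ∂ρ ∂ρ := by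
  classical
  have hΦ : Measurable fun (y : Fin n → Fin d → ℝ) k => ofAxes μ e (y k) :=
    measurable_pi_lambda _ fun k => (measurable_ofAxes μ e).comp (measurable_pi_apply k)
  have hE : MeasurableSet {y : Fin n → Fin d → ℝ | j ∈ nearest K (fun k => ofAxes μ e (y k)) i} :=
    hΦ (measurableSet_mem_nearest K i j)
  have hGm : Measurable fun y : Fin n → Fin d → ℝ => G (y i) (y j) :=
    hG.comp (show Measurable fun y : Fin n → Fin d → ℝ => (y i, y j) by fun_prop)
  rw [← lintegral_indicator hE, lintegral_pi_update _ i (hGm.indicator hE)]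
  refine lintegral_congr fun a => ?_
  refine (lintegral_pi_update _ j ((hGm.indicator hE).comp measurable_update_left)).trans ?_
  refine lintegral_congr fun b => ?_
  have hset : MeasurableSet {y : Fin n → Fin d → ℝ |
      ((Finset.univ.filter fun k => k ≠ i ∧ k ≠ j).filter
        fun k => y k ∈ closerSet j k a b).card < K} :=
    measurable_prodMk_left (x := (a, b)) (measurableSet_neighbour K i j)
  rw [neighbourProb, mul_comm, ← lintegral_indicator_const hset]
  refine lintegral_congr fun y => ?_
  set y' := Function.update (Function.update y j b) i a with hy'
  have hi : y' i = a := by simp [hy']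
  have hj : y' j = b := by simp [hy', hij.symm]
  have hiff : y' ∈ {y : Fin n → Fin d → ℝ | j ∈ nearest K (fun k => ofAxes μ e (y k)) i} ↔
      y ∈ {y : Fin n → Fin d → ℝ | ((Finset.univ.filter fun k => k ≠ i ∧ k ≠ j).filter
        fun k => y k ∈ closerSet j k a b).card < K} := by
    rw [Set.mem_ofPred_eq, mem_nearest_ofAxes K μ e y' hij, hi, hj, Set.mem_ofPred_eq]
    refine iff_of_eq (congrArg (fun s : Finset (Fin n) => s.card < K)
      (Finset.filter_congr fun k hk => ?_))
    have hk' := (Finset.mem_filter.1 hk).2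
    rw [hy', Function.update_of_ne hk'.1, Function.update_of_ne hk'.2]
  simp only [Function.comp_apply, ← hy', Set.indicator_apply, hiff, hi, hj]

/-- Along each principal axis, the nearest neighbours have at most the second moment of the base
record. -/
lemma lintegral_neighbour_coord_le (v : Fin d → NNReal) (K : ℕ)
    (μ : Record d) (e : OrthonormalBasis (Fin d) ℝ (Record d))
    {i j : Fin n} (hij : i ≠ j) (l : Fin d) :
    ∫⁻ y in {y | j ∈ nearest K (fun k => ofAxes μ e (y k)) i}, ENNReal.ofReal (y j l ^ 2)
        ∂(Measure.pi fun _ : Fin n => Measure.pi fun l => gaussianReal 0 (v l)) ≤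
      ∫⁻ y in {y | j ∈ nearest K (fun k => ofAxes μ e (y k)) i}, ENNReal.ofReal (y i l ^ 2)
        ∂(Measure.pi fun _ : Fin n => Measure.pi fun l => gaussianReal 0 (v l)) := by
  set ρ : Measure (Fin d → ℝ) := Measure.pi fun l => gaussianReal 0 (v l) with hρ
  have hq := measurable_neighbourProb ρ K i j
  have hg : Measurable fun t : ℝ => ENNReal.ofReal (t ^ 2) := by fun_prop
  have hG1 : Measurable (Function.uncurry fun (a _ : Fin d → ℝ) => ENNReal.ofReal (a l ^ 2)) := by
    simp only [Function.uncurry_def]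
    fun_prop
  have hG2 : Measurable (Function.uncurry fun (_ b : Fin d → ℝ) => ENNReal.ofReal (b l ^ 2)) := by
    simp only [Function.uncurry_def]
    fun_prop
  rw [lintegral_neighbour ρ K μ e hij (G := fun _ b => ENNReal.ofReal (b l ^ 2)) hG2,
    lintegral_neighbour ρ K μ e hij (G := fun a _ => ENNReal.ofReal (a l ^ 2)) hG1,
    lintegral_pi_update_update _ l (F := fun a b => neighbourProb ρ K i j a b *
      ENNReal.ofReal (b l ^ 2)) (hq.mul hG2),
    lintegral_pi_update_update _ l (F := fun a b => neighbourProb ρ K i j a b *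
      ENNReal.ofReal (a l ^ 2)) (hq.mul hG1)]
  simp only [Function.update_self]
  have hpull : ∀ s t : ℝ, ∀ c : ℝ≥0∞, c ≠ ∞ →
      ∫⁻ a, ∫⁻ b, neighbourProb ρ K i j (Function.update a l s) (Function.update b l t) * c ∂ρ ∂ρ =
      (∫⁻ a, ∫⁻ b, neighbourProb ρ K i j (Function.update a l s) (Function.update b l t) ∂ρ ∂ρ)
        * c := by
    intro s t c hc
    simp_rw [lintegral_mul_const' _ _ hc]
  simp only [← hρ, hpull _ _ _ ENNReal.ofReal_ne_top]
  -- The weight `Q s t` is the selection probability averaged over all coordinates other than the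
  -- two on axis `l`.
  refine lintegral_mul_le_of_swap (gaussianReal 0 (v l))
    (measurable_lintegral_lintegral_update _ l hq) hg fun s t hst => ?_
  refine lintegral_mono fun a => lintegral_mono fun b => ?_
  refine neighbourProb_le_swap v K i j a b l (sq_le_sq.1 ?_)
  exact (ENNReal.ofReal_le_ofReal_iff (sq_nonneg t)).1 hst

/-- The nearest neighbours of a Gaussian record are on average at most as far from the mean as
the record itself. -/
lemma lintegral_nearest_le (K : ℕ) (μ : Record d) {S : Matrix (Fin d) (Fin d) ℝ}
    (hS : S.PosSemidef) {i j : Fin n} (hij : i ≠ j) :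
    ∫⁻ x in {x | j ∈ nearest K x i}, ENNReal.ofReal (‖x j - μ‖ ^ 2) ∂(gaussianData n (μ, S)) ≤
      ∫⁻ x in {x | j ∈ nearest K x i}, ENNReal.ofReal (‖x i - μ‖ ^ 2)
        ∂(gaussianData n (μ, S)) := by
  set b := hS.isHermitian.eigenvectorBasis with hb
  have hm := measurable_ofAxes μ b
  have hΦ : Measurable fun (y : Fin n → Fin d → ℝ) k => ofAxes μ b (y k) :=
    measurable_pi_lambda _ fun k => hm.comp (measurable_pi_apply k)
  have hP : gaussianData n (μ, S) = (Measure.pi fun _ : Fin n =>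
      Measure.pi fun k => gaussianReal 0 (hS.isHermitian.eigenvalues k).toNNReal).map
      fun y k => ofAxes μ b (y k) := by
    have : IsProbabilityMeasure
      ((Measure.pi fun k => gaussianReal 0 (hS.isHermitian.eigenvalues k).toNNReal).map
        (ofAxes μ b)) := Measure.isProbabilityMeasure_map hm.aemeasurable
    rw [Measure.pi_map_pi fun _ => hm.aemeasurable, gaussianData]
    simp only [multivariateGaussian_eq_map_ofAxes μ hS, hb]
  have hset := measurableSet_mem_nearest (d := d) K i j
  have hco : ∀ k : Fin n, Measurable fun x : Dataset n d => ENNReal.ofReal (‖x k - μ‖ ^ 2) :=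
    fun k => by fun_prop
  rw [hP, setLIntegral_map hset (hco j) hΦ, setLIntegral_map hset (hco i) hΦ]
  simp only [norm_ofAxes_sub_sq, ENNReal.ofReal_sum_of_nonneg fun k _ => sq_nonneg _]
  rw [lintegral_finsetSum _ fun l _ => by fun_prop, lintegral_finsetSum _ fun l _ => by fun_prop]
  exact Finset.sum_le_sum fun l _ => lintegral_neighbour_coord_le _ K μ b hij l

end NeighbourMoments

/-! ### The law of a SMOTE sample -/

section Sampling

variable {n m d K : ℕ}

/-- `Closer x i` is a strict total order, so the number of predecessors ranks the `n - 1` other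
records bijectively by `0, …, n - 2`. As `K ≤ n - 1`, exactly `K` ranks lie below `K`. -/
lemma card_nearest (hKn : K < n) (x : Dataset n d) (i : Fin n) : (nearest K x i).card = K := by
  classical
  let r : Fin n → ℕ := fun j => (Finset.univ.filter fun k => k ≠ i ∧ Closer x i k j).card
  have hirr : ∀ j, ¬ Closer x i j j := fun j => by simp [Closer]
  have htrans : ∀ {a b c}, Closer x i a b → Closer x i b c → Closer x i a c := by
    rintro a b c (h1 | ⟨h1, h1'⟩) (h2 | ⟨h2, h2'⟩)
    · exact Or.inl (h1.trans h2)
    · exact Or.inl (h1.trans_eq h2)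
    · exact Or.inl (h1.trans_lt h2)
    · exact Or.inr ⟨h1.trans h2, h1'.trans h2'⟩
  have htri : ∀ {a b}, a ≠ b → Closer x i a b ∨ Closer x i b a := by
    intro a b hab
    rcases lt_trichotomy (dist (x a) (x i)) (dist (x b) (x i)) with h | h | h
    · exact Or.inl (Or.inl h)
    · exact hab.lt_or_gt.imp (fun h' => Or.inr ⟨h, h'⟩) fun h' => Or.inr ⟨h.symm, h'⟩
    · exact Or.inr (Or.inl h)
  have hlt : ∀ {a b}, a ≠ i → Closer x i a b → r a < r b := by
    intro a b ha hab
    refine Finset.card_lt_card ⟨fun k hk => ?_, fun hsub => ?_⟩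
    · simp only [Finset.mem_filter, Finset.mem_univ, true_and] at hk ⊢
      exact ⟨hk.1, htrans hk.2 hab⟩
    · have := hsub (show a ∈ _ by simpa using ⟨ha, hab⟩)
      exact hirr a (by simpa [ha] using this)
  have hinj : Set.InjOn r (Finset.univ.erase i : Finset (Fin n)) := by
    intro a ha b hb hab
    by_contra hne
    rcases htri hne with h | h
    · exact (hlt (by simpa using ha) h).ne hab
    · exact (hlt (by simpa using hb) h).ne' hab
  have himg : (Finset.univ.erase i).image r = Finset.range (n - 1) := by
    refine Finset.eq_of_subset_of_card_le (fun u hu => ?_) ?_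
    · obtain ⟨j, hj, rfl⟩ := Finset.mem_image.1 hu
      rw [Finset.mem_range]
      have hj' : j ∈ Finset.univ.erase i := hj
      calc r j < (Finset.univ.erase i).card := by
            refine Finset.card_lt_card ⟨fun k hk => ?_, fun hsub => ?_⟩
            · simp only [Finset.mem_filter, Finset.mem_univ, true_and] at hk
              simpa using hk.1
            · have := hsub hj'
              exact hirr j (by simpa using (Finset.mem_filter.1 this).2.2)
        _ = n - 1 := by simp
    · rw [Finset.card_image_of_injOn hinj]
      simp
  have hnear : nearest K x i = (Finset.univ.erase i).filter fun j => r j < K := by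
    ext j
    simp only [nearest, Finset.mem_filter, Finset.mem_univ, true_and, Finset.mem_erase, and_true]
    rfl
  have himg2 : (nearest K x i).image r = Finset.range K := by
    ext u
    rw [hnear, Finset.mem_image, Finset.mem_range]
    constructor
    · rintro ⟨j, hj, rfl⟩
      exact (Finset.mem_filter.1 hj).2
    · intro hu
      have : u ∈ (Finset.univ.erase i).image r := by
        rw [himg, Finset.mem_range]
        omega
      obtain ⟨j, hj, rfl⟩ := Finset.mem_image.1 this
      exact ⟨j, Finset.mem_filter.2 ⟨hj, hu⟩, rfl⟩
  have hinj' : Set.InjOn r (nearest K x i) := hinj.mono fun j hj => by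
    rw [hnear] at hj
    exact (Finset.mem_filter.1 (Finset.mem_coe.1 hj)).1
  rw [← Finset.card_image_of_injOn hinj', himg2, Finset.card_range]

lemma isProbabilityMeasure_smoteSample (hK : 1 ≤ K) (hKn : K < n) (x : Dataset n d) :
    IsProbabilityMeasure (smoteSample K x) := by
  have hK0 : (K : ℝ≥0∞) ≠ 0 := by exact_mod_cast (by omega : K ≠ 0)
  have hn0 : (n : ℝ≥0∞) ≠ 0 := by exact_mod_cast (by omega : n ≠ 0)
  refine ⟨?_⟩
  simp only [smoteSample, Measure.smul_apply, Measure.coe_finsetSum, Finset.sum_apply,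
    measure_univ, smul_eq_mul, Finset.sum_const, nsmul_eq_mul, mul_one, card_nearest hKn,
    ENNReal.inv_mul_cancel hK0 (ENNReal.natCast_ne_top K), Finset.card_univ, Fintype.card_fin,
    ENNReal.inv_mul_cancel hn0 (ENNReal.natCast_ne_top n)]

lemma recordLaw_eq_of_map_eval (hm : 1 ≤ m) {P : Measure (Dataset m d)} {ν : Measure (Record d)}
    (h : ∀ r, P.map (fun x => x r) = ν) : recordLaw P = ν := by
  have hm0 : (m : ℝ≥0∞) ≠ 0 := by exact_mod_cast (by omega : m ≠ 0)
  ext s hs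
  simp only [recordLaw, h, Finset.sum_const, Finset.card_univ, Fintype.card_fin, Measure.smul_apply,
    smul_eq_mul, nsmul_eq_mul]
  rw [← mul_assoc, ENNReal.inv_mul_cancel hm0 (ENNReal.natCast_ne_top m), one_mul]

lemma recordLaw_gaussianData (hn : 1 ≤ n) (θ : Record d × Matrix (Fin d) (Fin d) ℝ) :
    recordLaw (gaussianData n θ) = multivariateGaussian θ.1 θ.2 :=
  recordLaw_eq_of_map_eval hn fun r =>
    (measurePreserving_eval (fun _ => multivariateGaussian θ.1 θ.2) r).map_eq

/-- A record of the SMOTE-transformed dataset is one SMOTE sample from the random dataset. -/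
lemma recordLaw_bind_smote (hK : 1 ≤ K) (hKn : K < n) (hm : 1 ≤ m) (P : Measure (Dataset n d)) :
    recordLaw (P.bind (smote n m d K)) = P.bind (smoteSample K) := by
  refine recordLaw_eq_of_map_eval hm fun r => ?_
  ext s hs
  have hs' : MeasurableSet ((fun x : Dataset m d => x r) ⁻¹' s) := measurable_pi_apply r hs
  rw [Measure.map_apply (measurable_pi_apply r) hs, Measure.bind_apply hs'
    (smote n m d K).measurable.aemeasurable, Measure.bind_apply hs
    (measurable_smoteSample K).aemeasurable]
  refine lintegral_congr fun x => ?_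
  have := isProbabilityMeasure_smoteSample hK hKn x
  exact (measurePreserving_eval (fun _ : Fin m => smoteSample K x) r).measure_preimage
    hs.nullMeasurableSet

lemma lintegral_segmentLaw (a b : Record d) {f : Record d → ℝ≥0∞} (hf : Measurable f) :
    ∫⁻ z, f z ∂(segmentLaw a b) = ∫⁻ w in Set.Icc (0 : ℝ) 1, f (a + w • (b - a)) :=
  lintegral_map hf (by fun_prop)

open Classical in
lemma lintegral_bind_smoteSample (hKn : K < n) (P : Measure (Dataset n d))
    {f : Record d → ℝ≥0∞} (hf : Measurable f) :
    ∫⁻ z, f z ∂(P.bind (smoteSample K)) =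
      (n : ℝ≥0∞)⁻¹ * ∑ i, (K : ℝ≥0∞)⁻¹ * ∑ j, ∫⁻ x in {x | j ∈ nearest K x i},
        (∫⁻ w in Set.Icc (0 : ℝ) 1, f (x i + w • (x j - x i))) ∂P := by
  have hmeas : ∀ i j : Fin n, Measurable fun x : Dataset n d =>
      ∫⁻ w in Set.Icc (0 : ℝ) 1, f (x i + w • (x j - x i)) := by
    intro i j
    have : Measurable fun p : Dataset n d × ℝ => f (p.1 i + p.2 • (p.1 j - p.1 i)) :=
      hf.comp (by fun_prop)
    exact this.lintegral_prod_right'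
  have hind : ∀ i j : Fin n, Measurable ({x : Dataset n d | j ∈ nearest K x i}.indicator
      fun x => ∫⁻ w in Set.Icc (0 : ℝ) 1, f (x i + w • (x j - x i))) := fun i j =>
    (hmeas i j).indicator (measurableSet_mem_nearest K i j)
  rw [Measure.lintegral_bind (measurable_smoteSample K).aemeasurable hf.aemeasurable]
  have hx : ∀ x : Dataset n d, ∫⁻ z, f z ∂(smoteSample K x) =
      (n : ℝ≥0∞)⁻¹ * ∑ i, (K : ℝ≥0∞)⁻¹ * ∑ j, {x : Dataset n d | j ∈ nearest K x i}.indicator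
        (fun x => ∫⁻ w in Set.Icc (0 : ℝ) 1, f (x i + w • (x j - x i))) x := by
    intro x
    simp only [smoteSample, lintegral_smul_measure, lintegral_finsetSum_measure, smul_eq_mul,
      card_nearest hKn, lintegral_segmentLaw _ _ hf, Set.indicator_apply, Set.mem_ofPred_eq,
      Finset.sum_ite_mem, Finset.univ_inter]
  simp_rw [hx]
  rw [lintegral_const_mul _ (Finset.measurable_sum _ fun i _ =>
    (Finset.measurable_sum _ fun j _ => hind i j).const_mul _),
    lintegral_finsetSum _ fun i _ => (Finset.measurable_sum _ fun j _ => hind i j).const_mul _]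
  congr 1
  refine Finset.sum_congr rfl fun i _ => ?_
  rw [lintegral_const_mul _ (Finset.measurable_sum _ fun j _ => hind i j),
    lintegral_finsetSum _ fun j _ => hind i j]
  simp_rw [lintegral_indicator (measurableSet_mem_nearest K i _)]

/-- Summing over the nearest neighbours of a base record counts it `K` times. -/
lemma sum_setLIntegral_nearest (hKn : K < n) (P : Measure (Dataset n d)) (i : Fin n)
    {g : Dataset n d → ℝ≥0∞} (hg : Measurable g) :
    ∑ j, ∫⁻ x in {x | j ∈ nearest K x i}, g x ∂P = K * ∫⁻ x, g x ∂P := by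
  classical
  simp_rw [← lintegral_indicator (measurableSet_mem_nearest (d := d) K i _)]
  rw [← lintegral_finsetSum _ fun j _ => hg.indicator (measurableSet_mem_nearest K i j),
    ← lintegral_const_mul _ hg]
  refine lintegral_congr fun x => ?_
  simp only [Set.indicator_apply, Set.mem_ofPred_eq, Finset.sum_ite_mem, Finset.univ_inter,
    Finset.sum_const, card_nearest hKn, nsmul_eq_mul]

/-- The integrand is `(1 - w) ‖a‖² + w ‖b‖² - w (1 - w) ‖a - b‖²`, and `w (1 - w)` has integral `1 /
6`. -/
lemma integral_norm_segment_sq {E : Type*} [NormedAddCommGroup E] [InnerProductSpace ℝ E]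
    (a b : E) :
    ∫ w in Set.Icc (0 : ℝ) 1, ‖a + w • (b - a)‖ ^ 2 =
      (‖a‖ ^ 2 + ‖b‖ ^ 2) / 2 - ‖a - b‖ ^ 2 / 6 := by
  have h : ∀ w : ℝ, ‖a + w • (b - a)‖ ^ 2 =
      ‖a‖ ^ 2 + (w * (‖b‖ ^ 2 - ‖a‖ ^ 2 - ‖a - b‖ ^ 2) + w ^ 2 * ‖a - b‖ ^ 2) := by
    intro w
    have h1 : ‖b‖ ^ 2 = ‖a‖ ^ 2 + 2 * inner ℝ a (b - a) + ‖b - a‖ ^ 2 := by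
      rw [← norm_add_sq_real, add_sub_cancel]
    rw [norm_add_sq_real, inner_smul_right, norm_smul, mul_pow, Real.norm_eq_abs, sq_abs,
      norm_sub_rev a b, h1]
    ring
  simp_rw [h]
  rw [integral_Icc_eq_integral_Ioc, ← intervalIntegral.integral_of_le zero_le_one,
    intervalIntegral.integral_add (by simp) (Continuous.intervalIntegrable (by fun_prop) _ _),
    intervalIntegral.integral_add (Continuous.intervalIntegrable (by fun_prop) _ _)
      (Continuous.intervalIntegrable (by fun_prop) _ _),
    intervalIntegral.integral_mul_const, intervalIntegral.integral_mul_const, integral_id,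
    integral_pow]
  simp
  ring

lemma lintegral_norm_segment_sq {E : Type*} [NormedAddCommGroup E] [InnerProductSpace ℝ E]
    (a b μ : E) :
    (∫⁻ w in Set.Icc (0 : ℝ) 1, ENNReal.ofReal (‖a + w • (b - a) - μ‖ ^ 2)) +
        ENNReal.ofReal (‖a - b‖ ^ 2 / 6) =
      ENNReal.ofReal (‖a - μ‖ ^ 2 / 2) + ENNReal.ofReal (‖b - μ‖ ^ 2 / 2) := by
  have hi : Integrable (fun w : ℝ => ‖a + w • (b - a) - μ‖ ^ 2)
      (volume.restrict (Set.Icc (0 : ℝ) 1)) :=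
    (Continuous.continuousOn (by fun_prop)).integrableOn_Icc
  have h := integral_norm_segment_sq (a - μ) (b - μ)
  rw [sub_sub_sub_cancel_right, sub_sub_sub_cancel_right] at h
  have h' : ∀ w : ℝ, a - μ + w • (b - a) = a + w • (b - a) - μ := fun w => by abel
  simp_rw [h'] at h
  rw [← ofReal_integral_eq_lintegral_ofReal hi (Filter.Eventually.of_forall fun _ => sq_nonneg _),
    ← ENNReal.ofReal_add (integral_nonneg fun _ => sq_nonneg _) (by positivity),
    ← ENNReal.ofReal_add (by positivity) (by positivity), h]
  congr 1
  ring

end Sampling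

/-! ### Moments, symmetry and absence of atoms -/

section Moments

variable {d : ℕ}

lemma integrable_of_lintegral_sq_ne_top {M : Measure (Record d)} [IsProbabilityMeasure M]
    (c : Record d) (h : ∫⁻ z, ENNReal.ofReal (‖z - c‖ ^ 2) ∂M ≠ ∞) :
    Integrable (fun z => z) M := by
  have h1 : Integrable (fun z => z - c) M := by
    refine ⟨by fun_prop, ?_⟩
    refine lt_of_le_of_lt (b := ∫⁻ z, 1 + ENNReal.ofReal (‖z - c‖ ^ 2) ∂M)
      (lintegral_mono fun z => ?_) ?_
    · rw [← ofReal_norm, ← ENNReal.ofReal_one, ← ENNReal.ofReal_add zero_le_one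
        (sq_nonneg _)]
      exact ENNReal.ofReal_le_ofReal (by nlinarith [sq_nonneg (‖z - c‖ - 1), norm_nonneg (z - c)])
    · rw [lintegral_add_left measurable_const, lintegral_one, measure_univ]
      exact ENNReal.add_lt_top.2 ⟨ENNReal.one_lt_top, h.lt_top⟩
  refine (h1.add (integrable_const c)).congr (Filter.Eventually.of_forall fun z => ?_)
  exact sub_add_cancel z c

/-- The total variance is the second moment about the mean. -/
lemma ofReal_sum_variance {M : Measure (Record d)} [IsProbabilityMeasure M] {c : Record d}
    (h : ∫⁻ z, ENNReal.ofReal (‖z - c‖ ^ 2) ∂M ≠ ∞) (hc : ∫ z, z ∂M = c) :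
    ENNReal.ofReal (∑ a, Var[fun z : Record d => z a; M]) =
      ∫⁻ z, ENNReal.ofReal (‖z - c‖ ^ 2) ∂M := by
  have hsum : ∫⁻ z, ENNReal.ofReal (‖z - c‖ ^ 2) ∂M =
      ∑ a, eVar[fun z : Record d => z a; M] := by
    have hmean : ∀ a, ∫ z : Record d, z a ∂M = c a := by
      intro a
      have := (EuclideanSpace.proj (𝕜 := ℝ) a).integral_comp_comm
        (integrable_of_lintegral_sq_ne_top c h)
      rw [hc] at this
      simpa using this
    simp_rw [evariance_eq_lintegral_ofReal, hmean]
    rw [← lintegral_finsetSum _ fun a _ => by fun_prop]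
    refine lintegral_congr fun z => ?_
    rw [EuclideanSpace.real_norm_sq_eq, ENNReal.ofReal_sum_of_nonneg fun a _ => sq_nonneg _]
    simp
  rw [hsum] at h ⊢
  rw [ENNReal.ofReal_sum_of_nonneg fun a _ => variance_nonneg _ _]
  refine Finset.sum_congr rfl fun a _ => ?_
  exact ENNReal.ofReal_toReal (ENNReal.sum_ne_top.1 h a (Finset.mem_univ a))

lemma lintegral_multivariateGaussian_sq (μ : Record d) {S : Matrix (Fin d) (Fin d) ℝ}
    (hS : S.PosSemidef) :
    ∫⁻ z, ENNReal.ofReal (‖z - μ‖ ^ 2) ∂(multivariateGaussian μ S) = ENNReal.ofReal S.trace := by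
  have h2 : MemLp (fun z => z - μ) 2 (multivariateGaussian μ S) :=
    (IsGaussian.memLp_two_id).sub (memLp_const μ)
  have hi := h2.integrable_norm_pow (by simp)
  rw [← ofReal_sum_variance _ integral_id_multivariateGaussian]
  · simp_rw [variance_eval_multivariateGaussian hS]
    rfl
  · rw [← ofReal_integral_eq_lintegral_ofReal hi
      (Filter.Eventually.of_forall fun _ => sq_nonneg _)]
    exact ENNReal.ofReal_ne_top

/-- A nonzero semidefinite matrix has nonzero trace, hence a positive diagonal entry; that marginal
is a nondegenerate Gaussian without atoms. -/
lemma multivariateGaussian_singleton (μ : Record d) {S : Matrix (Fin d) (Fin d) ℝ}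
    (hS : S.PosSemidef) (hS0 : S ≠ 0) (p : Record d) : multivariateGaussian μ S {p} = 0 := by
  obtain ⟨l, hl⟩ : ∃ l, S l l ≠ 0 := by
    by_contra! h
    exact hS0 (hS.trace_eq_zero_iff.1 (Finset.sum_eq_zero fun l _ => h l))
  have hv : (S l l).toNNReal ≠ 0 := by
    have := lt_of_le_of_ne hS.diag_nonneg hl.symm
    simpa using this
  have := nullSingletonClass_gaussianReal (μ := μ l) hv
  refine measure_mono_null (t := (fun x : Record d => x l) ⁻¹' {p l}) ?_ ?_
  · rintro _ rfl
    rfl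
  · rw [(measurePreserving_eval_multivariateGaussian hS).measure_preimage
      (measurableSet_singleton _).nullMeasurableSet]
    exact measure_singleton _

lemma multivariateGaussian_map_reflection (μ : Record d) (S : Matrix (Fin d) (Fin d) ℝ) :
    (multivariateGaussian μ S).map (fun z => μ + (μ - z)) = multivariateGaussian μ S := by
  have h := stdGaussian_map (LinearIsometryEquiv.neg ℝ (E := Record d))
  rw [multivariateGaussian, Measure.map_map (by fun_prop) (by fun_prop)]
  conv_rhs => rw [← h]
  rw [Measure.map_map (by fun_prop) (by fun_prop)]
  congr 1
  ext1 x
  simp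

lemma gaussianData_eq_eq_zero {n : ℕ} (μ : Record d) {S : Matrix (Fin d) (Fin d) ℝ}
    (hS : S.PosSemidef) (hS0 : S ≠ 0) {i j : Fin n} (hij : i ≠ j) :
    gaussianData n (μ, S) {x | x i = x j} = 0 := by
  have hm : MeasurableSet {x : Dataset n d | x i = x j} :=
    measurableSet_eq_fun (measurable_pi_apply i) (measurable_pi_apply j)
  have hmp := measurePreserving_update (fun _ : Fin n => multivariateGaussian μ S) i
  rw [gaussianData, ← hmp.measure_preimage hm.nullMeasurableSet,
    Measure.prod_apply (hmp.measurable hm)]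
  refine (lintegral_congr fun x => ?_).trans lintegral_zero
  convert multivariateGaussian_singleton μ hS hS0 (x j) using 2
  ext u
  simp [hij.symm]

end Moments

/-! ### Strict loss of variance and preservation of the mean -/

variable {n m d K : ℕ}

instance (n : ℕ) (θ : Record d × Matrix (Fin d) (Fin d) ℝ) :
    IsProbabilityMeasure (gaussianData n θ) := by
  unfold gaussianData
  infer_instance

/-- This is the source of strictness. Distinct records almost surely differ, so a zero sum would
make every selection event null, whereas their probabilities add up to `K ≥ 1`. -/
lemma sum_setLIntegral_nearest_dist_ne_zero (hK : 1 ≤ K) (hKn : K < n) (μ : Record d)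
    {S : Matrix (Fin d) (Fin d) ℝ} (hS : S.PosSemidef) (hS0 : S ≠ 0) (i : Fin n) :
    ∑ j, ∫⁻ x in {x | j ∈ nearest K x i}, ENNReal.ofReal (‖x i - x j‖ ^ 2 / 6)
      ∂(gaussianData n (μ, S)) ≠ 0 := by
  intro h
  have hnull : ∀ j, gaussianData n (μ, S) {x | j ∈ nearest K x i} = 0 := by
    intro j
    rcases eq_or_ne i j with rfl | hij
    · simp [nearest]
    have hj := Finset.sum_eq_zero_iff.1 h j (Finset.mem_univ j)
    rw [lintegral_eq_zero_iff (by fun_prop), Filter.EventuallyEq,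
      ae_restrict_iff' (measurableSet_mem_nearest K i j)] at hj
    have hne : ∀ᵐ x ∂(gaussianData n (μ, S)), x i ≠ x j := by
      rw [ae_iff]
      simpa using gaussianData_eq_eq_zero μ hS hS0 hij
    rw [measure_eq_zero_iff_ae_notMem]
    filter_upwards [hj, hne] with x hx hx' hmem
    have h1 := ENNReal.ofReal_eq_zero.1 (hx hmem)
    have h2 : 0 < ‖x i - x j‖ := norm_pos_iff.2 (sub_ne_zero.2 hx')
    have h3 : 0 < ‖x i - x j‖ ^ 2 / 6 := by positivity
    linarith
  have hsum := sum_setLIntegral_nearest (K := K) hKn (gaussianData n (μ, S)) i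
    (measurable_const (a := (1 : ℝ≥0∞)))
  simp only [lintegral_one, Measure.restrict_apply_univ, hnull, Finset.sum_const_zero,
    measure_univ, mul_one] at hsum
  exact absurd hsum.symm (by exact_mod_cast (by omega : K ≠ 0))

/-- The second moment of a SMOTE sample about the mean is strictly below the total variance of
the data. -/
lemma lintegral_smote_sq_lt (hK : 1 ≤ K) (hKn : K < n) (μ : Record d)
    {S : Matrix (Fin d) (Fin d) ℝ} (hS : S.PosSemidef) (hS0 : S ≠ 0) :
    ∫⁻ z, ENNReal.ofReal (‖z - μ‖ ^ 2) ∂((gaussianData n (μ, S)).bind (smoteSample K)) <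
      ENNReal.ofReal S.trace := by
  set P := gaussianData n (μ, S) with hP
  have hK0 : (K : ℝ≥0∞) ≠ 0 := by exact_mod_cast (by omega : K ≠ 0)
  have hn0 : (n : ℝ≥0∞) ≠ 0 := by exact_mod_cast (by omega : n ≠ 0)
  rw [lintegral_bind_smoteSample hKn P (by fun_prop)]
  set A : Fin n → Fin n → ℝ≥0∞ := fun i j => ∫⁻ x in {x | j ∈ nearest K x i},
    (∫⁻ w in Set.Icc (0 : ℝ) 1, ENNReal.ofReal (‖x i + w • (x j - x i) - μ‖ ^ 2)) ∂P with hA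
  set B : Fin n → Fin n → ℝ≥0∞ := fun i j => ∫⁻ x in {x | j ∈ nearest K x i},
    ENNReal.ofReal (‖x i - x j‖ ^ 2 / 6) ∂P with hB
  have hhalf : ∀ u : ℝ, ENNReal.ofReal (u / 2) = ENNReal.ofReal 2⁻¹ * ENNReal.ofReal u :=
    fun u => by rw [← ENNReal.ofReal_mul (by norm_num)]; congr 1; ring
  -- The segment identity gives half of each endpoint's second moment; the neighbour's half is at
  -- most the base's half.
  have hAB : ∀ i j, A i j + B i j ≤
      ∫⁻ x in {x | j ∈ nearest K x i}, ENNReal.ofReal (‖x i - μ‖ ^ 2) ∂P := by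
    intro i j
    simp only [hA, hB]
    rw [← lintegral_add_right _ (by fun_prop)]
    simp_rw [lintegral_norm_segment_sq, hhalf]
    rw [lintegral_add_right _ (by fun_prop), lintegral_const_mul _ (by fun_prop),
      lintegral_const_mul _ (by fun_prop)]
    have hle : ∫⁻ x in {x | j ∈ nearest K x i}, ENNReal.ofReal (‖x j - μ‖ ^ 2) ∂P ≤
        ∫⁻ x in {x | j ∈ nearest K x i}, ENNReal.ofReal (‖x i - μ‖ ^ 2) ∂P := by
      rcases eq_or_ne i j with rfl | hij
      · rfl
      · exact lintegral_nearest_le K μ hS hij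
    refine (add_le_add_right (mul_le_mul_right hle _) _).trans ?_
    rw [← add_mul, ← ENNReal.ofReal_add (by norm_num) (by norm_num)]
    norm_num
  have hbase : ∀ i : Fin n, ∫⁻ x, ENNReal.ofReal (‖x i - μ‖ ^ 2) ∂P = ENNReal.ofReal S.trace := by
    intro i
    rw [← lintegral_multivariateGaussian_sq μ hS]
    exact (measurePreserving_eval (fun _ : Fin n => multivariateGaussian μ S) i).lintegral_comp
      (f := fun z => ENNReal.ofReal (‖z - μ‖ ^ 2)) (by fun_prop)
  have htotal : (n : ℝ≥0∞)⁻¹ * ∑ i, (K : ℝ≥0∞)⁻¹ * ∑ j, A i j +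
      (n : ℝ≥0∞)⁻¹ * ∑ i, (K : ℝ≥0∞)⁻¹ * ∑ j, B i j ≤ ENNReal.ofReal S.trace := by
    simp only [← mul_add, ← Finset.sum_add_distrib]
    calc (n : ℝ≥0∞)⁻¹ * ∑ i, (K : ℝ≥0∞)⁻¹ * ∑ j, (A i j + B i j)
        ≤ (n : ℝ≥0∞)⁻¹ * ∑ i : Fin n, (K : ℝ≥0∞)⁻¹ * (K * ENNReal.ofReal S.trace) := by
          gcongr with i _
          rw [← hbase i, ← sum_setLIntegral_nearest hKn P i (by fun_prop)]
          exact Finset.sum_le_sum fun j _ => hAB i j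
      _ = ENNReal.ofReal S.trace := by
          rw [← mul_assoc, ENNReal.inv_mul_cancel hK0 (ENNReal.natCast_ne_top K), one_mul,
            Finset.sum_const, Finset.card_univ, Fintype.card_fin, nsmul_eq_mul, ← mul_assoc,
            ENNReal.inv_mul_cancel hn0 (ENNReal.natCast_ne_top n), one_mul]
  -- Dropping the `B` term is strict only if the `A` term is finite and the `B` term is nonzero.
  refine lt_of_lt_of_le (ENNReal.lt_add_right ?_ ?_) htotal
  · exact ne_top_of_le_ne_top ENNReal.ofReal_ne_top (le_self_add.trans htotal)
  · refine mul_ne_zero (ENNReal.inv_ne_zero.2 (ENNReal.natCast_ne_top n)) fun h0 => ?_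
    have h1 := Finset.sum_eq_zero_iff.1 h0 ⟨0, by omega⟩ (Finset.mem_univ _)
    rcases mul_eq_zero.1 h1 with h2 | h2
    · exact ENNReal.inv_ne_zero.2 (ENNReal.natCast_ne_top K) h2
    · exact sum_setLIntegral_nearest_dist_ne_zero hK hKn μ hS hS0 _ h2

/-- A point reflection is an isometry, so it keeps the neighbour lists, and it is affine, so it
commutes with interpolation. -/
lemma smoteSample_reflection (μ : Record d) (x : Dataset n d) :
    smoteSample K (fun k => μ + (μ - x k)) = (smoteSample K x).map fun z => μ + (μ - z) := by
  have hd : ∀ a b : Record d, dist (μ + (μ - a)) (μ + (μ - b)) = dist a b := fun a b => by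
    rw [dist_add_left, dist_sub_left]
  have hnear : ∀ i, nearest K (fun k => μ + (μ - x k)) i = nearest K x i := by
    intro i
    have hc : Closer (fun k => μ + (μ - x k)) = Closer x := by
      funext i k j
      simp only [Closer, hd]
    rw [nearest, hc, nearest]
  have hseg : ∀ a b : Record d, segmentLaw (μ + (μ - a)) (μ + (μ - b)) =
      (segmentLaw a b).map fun z => μ + (μ - z) := by
    intro a b
    rw [segmentLaw, segmentLaw, Measure.map_map (by fun_prop) (by fun_prop)]
    congr 1
    ext1 w
    simp only [Function.comp_apply, smul_sub, smul_add]
    abel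
  ext s hs
  rw [Measure.map_apply (by fun_prop) hs]
  simp only [smoteSample, hnear, hseg, Measure.smul_apply, Measure.coe_finsetSum,
    Finset.sum_apply, Measure.map_apply (show Measurable fun z : Record d => μ + (μ - z) by
      fun_prop) hs]

lemma isProbabilityMeasure_bind_smoteSample (hK : 1 ≤ K) (hKn : K < n)
    (P : Measure (Dataset n d)) [IsProbabilityMeasure P] :
    IsProbabilityMeasure (P.bind (smoteSample K)) := by
  refine ⟨?_⟩
  rw [Measure.bind_apply MeasurableSet.univ (measurable_smoteSample K).aemeasurable]
  have h : ∀ x : Dataset n d, smoteSample K x Set.univ = 1 := fun x =>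
    (isProbabilityMeasure_smoteSample hK hKn x).measure_univ
  simp [h]

/-- SMOTE does not change the mean of Gaussian data. -/
lemma integral_bind_smoteSample (hK : 1 ≤ K) (hKn : K < n) (μ : Record d)
    {S : Matrix (Fin d) (Fin d) ℝ} (hS : S.PosSemidef) (hS0 : S ≠ 0) :
    ∫ z, z ∂((gaussianData n (μ, S)).bind (smoteSample K)) = μ := by
  set M := (gaussianData n (μ, S)).bind (smoteSample K) with hM
  have hprob : IsProbabilityMeasure M :=
    isProbabilityMeasure_bind_smoteSample hK hKn (gaussianData n (μ, S))
  have hR : Measurable fun z : Record d => μ + (μ - z) := by fun_prop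
  have hT : Measurable fun (x : Dataset n d) k => μ + (μ - x k) := by fun_prop
  have hPT : (gaussianData n (μ, S)).map (fun x k => μ + (μ - x k)) = gaussianData n (μ, S) := by
    have : IsProbabilityMeasure ((multivariateGaussian μ S).map fun z => μ + (μ - z)) :=
      Measure.isProbabilityMeasure_map hR.aemeasurable
    rw [gaussianData, Measure.pi_map_pi fun _ => hR.aemeasurable]
    simp only [multivariateGaussian_map_reflection]
  have hMR : M.map (fun z => μ + (μ - z)) = M := by
    ext s hs
    have hms : Measurable fun x : Dataset n d => smoteSample K x s :=
      (Measure.measurable_coe hs).comp (measurable_smoteSample K)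
    rw [Measure.map_apply hR hs, hM, Measure.bind_apply (hR hs)
      (measurable_smoteSample K).aemeasurable, Measure.bind_apply hs
      (measurable_smoteSample K).aemeasurable]
    conv_rhs => rw [← hPT]
    rw [lintegral_map hms hT]
    refine lintegral_congr fun x => ?_
    rw [smoteSample_reflection, Measure.map_apply hR hs]
  have hi : Integrable (fun z => z) M := integrable_of_lintegral_sq_ne_top μ
    ((lintegral_smote_sq_lt hK hKn μ hS hS0).trans ENNReal.ofReal_lt_top).ne
  -- Reflection invariance makes the mean a fixed point of the reflection, whose only fixed point is
  -- `μ`.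
  have h1 : ∫ z, z ∂M = μ + (μ - ∫ z, z ∂M) := by
    conv_lhs => rw [← hMR]
    rw [integral_map hR.aemeasurable (by fun_prop), integral_add
      (g := fun z => μ - z) (integrable_const μ) ((integrable_const μ).sub hi),
      integral_sub (integrable_const μ) hi]
    simp
  have h2 : (2 : ℝ) • ∫ z, z ∂M = (2 : ℝ) • μ := by
    rw [two_smul, two_smul]
    nth_rewrite 1 [h1]
    abel
  exact smul_right_injective _ (two_ne_zero (α := ℝ)) h2

/-! ### Comparison of the sensitivities -/

lemma trace_dataCov (P : Measure (Dataset m d)) :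
    (dataCov P).trace = ∑ a, Var[fun z : Record d => z a; recordLaw P] := by
  refine Finset.sum_congr rfl fun a _ => ?_
  exact covariance_self (by fun_prop)

lemma dataMean_gaussianData (hn : 1 ≤ n) (θ : Record d × Matrix (Fin d) (Fin d) ℝ) :
    dataMean (gaussianData n θ) = θ.1 := by
  rw [dataMean, recordLaw_gaussianData hn, integral_id_multivariateGaussian]

lemma trace_dataCov_gaussianData (hn : 1 ≤ n) {θ : Record d × Matrix (Fin d) (Fin d) ℝ}
    (hθ : θ.2.PosSemidef) : (dataCov (gaussianData n θ)).trace = θ.2.trace := by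
  rw [trace_dataCov, recordLaw_gaussianData hn]
  simp_rw [variance_eval_multivariateGaussian hθ]
  rfl

lemma dataMean_smote (hK : 1 ≤ K) (hKn : K < n) (hm : 1 ≤ m)
    {θ : Record d × Matrix (Fin d) (Fin d) ℝ} (hθ : θ.2.PosSemidef) (hθ0 : θ.2 ≠ 0) :
    dataMean ((gaussianData n θ).bind (smote n m d K)) = θ.1 := by
  rw [dataMean, recordLaw_bind_smote hK hKn hm]
  exact integral_bind_smoteSample hK hKn θ.1 hθ hθ0

/-- Since the SMOTE mean is exactly `μ`, the total variance is the second moment about `μ`, already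
bounded in `lintegral_smote_sq_lt`. -/
lemma trace_dataCov_smote_lt (hK : 1 ≤ K) (hKn : K < n) (hm : 1 ≤ m)
    {θ : Record d × Matrix (Fin d) (Fin d) ℝ} (hθ : θ.2.PosSemidef) (hθ0 : θ.2 ≠ 0) :
    (dataCov ((gaussianData n θ).bind (smote n m d K))).trace < θ.2.trace := by
  have hlt := lintegral_smote_sq_lt hK hKn θ.1 hθ hθ0
  have := isProbabilityMeasure_bind_smoteSample hK hKn (gaussianData n θ)
  rw [← ofReal_sum_variance (hlt.trans ENNReal.ofReal_lt_top).ne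
    (integral_bind_smoteSample hK hKn θ.1 hθ hθ0)] at hlt
  rw [trace_dataCov, recordLaw_bind_smote hK hKn hm]
  exact (ENNReal.ofReal_lt_ofReal_iff_of_nonneg
    (Finset.sum_nonneg fun a _ => variance_nonneg _ _)).1 hlt

/-- The contribution of a pair of parameters to the sensitivity of the generative model `f`. -/
noncomputable def sensitivityValue (f : Kernel (Dataset n d) (Dataset m d))
    (θ θ' : Record d × Matrix (Fin d) (Fin d) ℝ) : ℝ :=
  ‖dataMean ((gaussianData n θ).bind f) - dataMean ((gaussianData n θ').bind f)‖ +
    (dataCov ((gaussianData n θ).bind f) + dataCov ((gaussianData n θ').bind f)).trace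

/-- Both marginals of a coupling are fixed by the parameters, so the coupling matters only through
its existence. -/
lemma mem_sensitivityValues {Θ : Set (Record d × Matrix (Fin d) (Fin d) ℝ)}
    {f : Kernel (Dataset n d) (Dataset m d)} {v : ℝ} :
    v ∈ sensitivityValues Θ f ↔ ∃ θ ∈ Θ, ∃ θ' ∈ Θ,
      (∃ π : Measure (Dataset n d × Dataset n d), IsNeighbouring θ θ' π) ∧
      v = sensitivityValue f θ θ' := by
  constructor
  · rintro ⟨θ, hθ, θ', hθ', π, hπ, rfl⟩
    exact ⟨θ, hθ, θ', hθ', ⟨π, hπ⟩, by rw [hπ.1, hπ.2.1, sensitivityValue]⟩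
  · rintro ⟨θ, hθ, θ', hθ', ⟨π, hπ⟩, rfl⟩
    exact ⟨θ, hθ, θ', hθ', π, hπ, by rw [hπ.1, hπ.2.1, sensitivityValue]⟩

/-- A dataset is a neighbour of itself. -/
lemma exists_isNeighbouring_self (θ : Record d × Matrix (Fin d) (Fin d) ℝ) :
    ∃ π : Measure (Dataset n d × Dataset n d), IsNeighbouring θ θ π := by
  classical
  have hm : Measurable fun x : Dataset n d => (x, x) := by fun_prop
  refine ⟨(gaussianData n θ).map fun x => (x, x), ?_, ?_, ?_⟩
  · rw [Measure.fst, Measure.map_map measurable_fst hm]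
    exact Measure.map_id
  · rw [Measure.snd, Measure.map_map measurable_snd hm]
    exact Measure.map_id
  · rw [ae_iff]
    have hdiag : MeasurableSet {p : Dataset n d × Dataset n d | p.1 = p.2} :=
      measurableSet_eq_fun measurable_fst measurable_snd
    refine measure_mono_null (t := {p : Dataset n d × Dataset n d | p.1 = p.2}ᶜ) ?_ ?_
    · intro p hp hp'
      refine hp ?_
      rw [show p.1 = p.2 from hp', hammingDist_self]
      exact zero_le_one
    · rw [Measure.map_apply hm hdiag.compl]
      simp

/-- Finitely many parameter pairs give finitely many values, and the diagonal coupling provides one.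
-/
lemma exists_isSensitivity {Θ : Set (Record d × Matrix (Fin d) (Fin d) ℝ)} (hfin : Θ.Finite)
    (hne : Θ.Nonempty) (f : Kernel (Dataset n d) (Dataset m d)) :
    ∃ Δ : ℝ, IsSensitivity Θ f Δ := by
  have hsub : sensitivityValues Θ f ⊆
      (fun p : (Record d × Matrix (Fin d) (Fin d) ℝ) × (Record d × Matrix (Fin d) (Fin d) ℝ) =>
        sensitivityValue f p.1 p.2) '' (Θ ×ˢ Θ) := by
    intro v hv
    obtain ⟨θ, hθ, θ', hθ', _, rfl⟩ := mem_sensitivityValues.1 hv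
    exact ⟨(θ, θ'), ⟨hθ, hθ'⟩, rfl⟩
  obtain ⟨θ, hθ⟩ := hne
  have hne : (sensitivityValues Θ f).Nonempty :=
    ⟨_, mem_sensitivityValues.2 ⟨θ, hθ, θ, hθ, exists_isNeighbouring_self θ, rfl⟩⟩
  have hfinV := ((hfin.prod hfin).image _).subset hsub
  exact ⟨sSup (sensitivityValues Θ f), hne.csSup_mem hfinV, fun v hv => le_csSup hfinV.bddAbove hv⟩

lemma sensitivityValue_smote_lt (hK : 1 ≤ K) (hKn : K < n) (hm : 1 ≤ m)
    {θ θ' : Record d × Matrix (Fin d) (Fin d) ℝ} (hθ : θ.2.PosSemidef ∧ θ.2 ≠ 0)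
    (hθ' : θ'.2.PosSemidef ∧ θ'.2 ≠ 0) :
    sensitivityValue (smote n m d K) θ θ' <
      sensitivityValue (Kernel.id : Kernel (Dataset n d) _) θ θ' := by
  have hn : 1 ≤ n := by omega
  have hid : ∀ θ, (gaussianData n θ).bind (Kernel.id : Kernel (Dataset n d) _) =
      gaussianData n θ := fun θ => Measure.bind_dirac
  rw [sensitivityValue, sensitivityValue, hid, hid, dataMean_smote hK hKn hm hθ.1 hθ.2,
    dataMean_smote hK hKn hm hθ'.1 hθ'.2, dataMean_gaussianData hn, dataMean_gaussianData hn,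
    Matrix.trace_add, Matrix.trace_add, trace_dataCov_gaussianData hn hθ.1,
    trace_dataCov_gaussianData hn hθ'.1]
  have h1 := trace_dataCov_smote_lt hK hKn hm hθ.1 hθ.2
  have h2 := trace_dataCov_smote_lt hK hKn hm hθ'.1 hθ'.2
  linarith

end SmoteDP

theorem theorem1 {n m d K : ℕ} (hK : 1 ≤ K) (hKn : K < n) (hm : 1 ≤ m)
    (Θ : Set (SmoteDP.Record d × Matrix (Fin d) (Fin d) ℝ))
    (hΘ : ∀ θ ∈ Θ, θ.2.PosSemidef ∧ θ.2 ≠ 0) :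
    (∀ Δf Δfs : ℝ, SmoteDP.IsSensitivity Θ (Kernel.id : Kernel (SmoteDP.Dataset n d) _) Δf →
      SmoteDP.IsSensitivity Θ (SmoteDP.smote n m d K) Δfs → Δfs < Δf) ∧
    (Θ.Finite → Θ.Nonempty →
      (∃ Δf : ℝ, SmoteDP.IsSensitivity Θ (Kernel.id : Kernel (SmoteDP.Dataset n d) _) Δf) ∧
      ∃ Δfs : ℝ, SmoteDP.IsSensitivity Θ (SmoteDP.smote n m d K) Δfs) := by
  refine ⟨fun Δf Δfs hf hfs => ?_, fun hfin hne =>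
    ⟨SmoteDP.exists_isSensitivity hfin hne _, SmoteDP.exists_isSensitivity hfin hne _⟩⟩
  -- The SMOTE maximum is attained, and its pair also competes for `Δf`, so the strict inequality
  -- survives passing to maxima.
  obtain ⟨θ, hθ, θ', hθ', hπ, rfl⟩ := SmoteDP.mem_sensitivityValues.1 hfs.1
  exact (SmoteDP.sensitivityValue_smote_lt hK hKn hm (hΘ θ hθ) (hΘ θ' hθ')).trans_le
    (hf.2 (SmoteDP.mem_sensitivityValues.2 ⟨θ, hθ, θ', hθ', hπ, rfl⟩))
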